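/- Let $d\in\mathbb N$, let $\Phi:\mathbb R^{2d}\to\mathbb R$ be a tame phase, that is, $\Phi\in C^\infty(\mathbb R^{2d})$, all derivatives of $\Phi$ of order at least $2$ are bounded, and there is $\delta>0$ with $|\det\partial^2_{x,\eta}\Phi(x,\eta)|\ge\delta$ for all $x,\eta\in\mathbb R^d$. Let $\sigma\in S^0_{0,0}(\mathbb R^{2d})$, that is, $\sigma:\mathbb R^{2d}\to\mathbb C$ is smooth and bounded together with all its derivatives. For $f\in\mathcal S(\mathbb R^d)$ let $$T_If(x)=\int_{\mathbb R^d}e^{2\pi i\Phi(x,\xi)}\sigma(x,\xi)\hat f(\xi)\,d\xi,\qquad \hat f(\xi)=\int_{\mathbb R^d} f(x)e^{-2\pi ix\cdot\xi}\,dx,$$ and let $W(f,g)(x,\xi)=\int_{\mathbb R^d}f(x+\tfrac t2)\overline{g(x-\tfrac t2)}e^{-2\pi it\cdot\xi}\,dt$ be the cross-Wigner distribution. Put $$\Phi_I(x,\eta,t,r)=\Phi(x+\tfrac t2,\eta+\tfrac r2)-\Phi(x-\tfrac t2,\eta-\tfrac r2),\qquad \sigma_I(x,\eta,t,r)=\sigma(x+\tfrac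 t2,\eta+\tfrac r2)\,\overline{\sigma(x-\tfrac t2,\eta-\tfrac r2)},$$ and $$k_I(x,\xi,y,\eta)=\int_{\mathbb R^{2d}}e^{2\pi i[\Phi_I(x,\eta,t,r)-(\xi\cdot t+r\cdot y)]}\sigma_I(x,\eta,t,r)\,dt\,dr,$$ where the integral is understood as the partial Fourier transform $(t,r)\mapsto(\xi,y)$, in the sense of tempered distributions, of the bounded function $e^{2\pi i\Phi_I}\sigma_I$ on $\mathbb R^{4d}$. Then: 1. $T_If\in L^2(\mathbb R^d)$ for every $f\in\mathcal S(\mathbb R^d)$, so that $W(T_If,T_Ig)$ is defined for all $f,g\in\mathcal S(\mathbb R^d)$. 2. $k_I$ is a tempered distribution on $\mathbb R^{4d}$ and is the Wigner kernel of $T_I$, that is, $\langle W(T_If,T_Ig),W(u,v)\rangle=\langle k_I,W(u,v)\otimes\overline{W(f,g)}\rangle$ for all $f,g,u,v\in\mathcal S(\mathbb R^d)$, where the brackets are conjugate-linear in the second entry. Moreover, for all $f,g\in\mathcal S(\mathbb R^d)$, $$W(T_If,T_Ig)(x,\xi)=\int_{\mathbb R^{2d}}k_I(x,\xi,y,\eta)\,W(f,g)(y,\eta)\,dy\,d\eta$$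 in $\mathcal S'(\mathbb R^{2d})$, that is, $\int W(T_If,T_Ig)\,\Theta\,dx\,d\xi=k_I(\Theta\otimes W(f,g))$, with $k_I$ acting linearly, for all $\Theta\in\mathcal S(\mathbb R^{2d})$. 3. The last displayed identity also holds at every point $(x,\xi)\in\mathbb R^{2d}$, with its right-hand side read as the iterated oscillatory integral $$\int_{\mathbb R^d}e^{-2\pi i\xi\cdot t}\left(\int_{\mathbb R^{2d}}e^{2\pi i\Phi_I(x,\eta,t,r)}\sigma_I(x,\eta,t,r)\left(\int_{\mathbb R^d}e^{-2\pi ir\cdot y}W(f,g)(y,\eta)\,dy\right)d\eta\,dr\right)dt,$$ in which the outer integrand is integrable in $t$. -/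

import Mathlib

open MeasureTheory
open scoped SchwartzMap FourierTransform ContDiff

noncomputable section

/-- The space `ℝ^d` with its Euclidean structure. -/
abbrev Rd (d : ℕ) : Type := EuclideanSpace ℝ (Fin d)

/-- The `d × d` matrix of mixed derivatives `∂² Φ / ∂x_i ∂η_j` at the point `z = (x, η)`. -/
def mixedHessian {d : ℕ} (Φ : Rd d × Rd d → ℝ) (z : Rd d × Rd d) :
    Matrix (Fin d) (Fin d) ℝ :=
  Matrix.of fun i j =>
    fderiv ℝ (fderiv ℝ Φ) z (EuclideanSpace.single i 1, 0) (0, EuclideanSpace.single j 1)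

/-- Tame phase functions on `ℝ^{2d}`: smooth, with all derivatives of order at least two bounded
(a bound on all partial derivatives of order `n` is the same as a bound on the norm of the `n`-th
Fréchet derivative), and with uniformly nondegenerate mixed Hessian. -/
structure IsTamePhase {d : ℕ} (Φ : Rd d × Rd d → ℝ) : Prop where
  smooth : ContDiff ℝ ∞ Φ
  bounded_deriv : ∀ n : ℕ, 2 ≤ n → ∃ C : ℝ, ∀ z, ‖iteratedFDeriv ℝ n Φ z‖ ≤ C
  nondegenerate : ∃ δ : ℝ, 0 < δ ∧ ∀ z, δ ≤ |(mixedHessian Φ z).det|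

/-- The Hörmander class `S^0_{0,0}(ℝ^{2d})`: smooth functions that are bounded together with all
their derivatives. -/
structure IsHormanderSymbol {d : ℕ} (σ : Rd d × Rd d → ℂ) : Prop where
  smooth : ContDiff ℝ ∞ σ
  bounded_deriv : ∀ n : ℕ, ∃ C : ℝ, ∀ z, ‖iteratedFDeriv ℝ n σ z‖ ≤ C

/-- The Fourier integral operator of type I with phase `Φ` and symbol `σ`,
`T_I f (x) = ∫ e^{2πi Φ(x,ξ)} σ(x,ξ) f̂(ξ) dξ`, where `f̂(ξ) = ∫ f(x) e^{-2πi x·ξ} dx`. -/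
def fioTypeI {d : ℕ} (Φ : Rd d × Rd d → ℝ) (σ : Rd d × Rd d → ℂ) (f : 𝓢(Rd d, ℂ)) (x : Rd d) : ℂ :=
  ∫ ξ : Rd d, Complex.exp (2 * Real.pi * Complex.I * Φ (x, ξ)) * σ (x, ξ) * (𝓕 f) ξ

/-- The cross-Wigner distribution
`W(f,g)(x,ξ) = ∫ f(x + t/2) conj(g(x - t/2)) e^{-2πi t·ξ} dt`. -/
def crossWigner {d : ℕ} (f g : Rd d → ℂ) (z : Rd d × Rd d) : ℂ :=
  ∫ t : Rd d, f (z.1 + (1 / 2 : ℝ) • t) * starRingEnd ℂ (g (z.1 - (1 / 2 : ℝ) • t)) *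
    Complex.exp (-(2 * Real.pi * Complex.I * (inner ℝ t z.2 : ℝ)))

/-- `k ∈ S'(ℝ^{4d})` is a Wigner kernel of the operator `T`, defined on `S(ℝ^d)` and with values in
`L²(ℝ^d)`: `⟨W(Tf,Tg), W(u,v)⟩ = ⟨k, W(u,v) ⊗ conj W(f,g)⟩` for all `f, g, u, v ∈ S(ℝ^d)`.
The brackets of the definition are conjugate-linear in the second entry, whereas `k Ψ` is linear in
`Ψ`, so `k` is applied to `conj W(u,v) ⊗ W(f,g)`, which is asserted to be a Schwartz function. -/
def IsWignerKernel {d : ℕ} (T : 𝓢(Rd d, ℂ) → Rd d → ℂ)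
    (k : 𝓢'((Rd d × Rd d) × (Rd d × Rd d), ℂ)) : Prop :=
  ∀ f g u v : 𝓢(Rd d, ℂ), ∃ Ψ : 𝓢((Rd d × Rd d) × (Rd d × Rd d), ℂ),
    (∀ z w, Ψ (z, w) = starRingEnd ℂ (crossWigner u v z) * crossWigner f g w) ∧
    ∫ z, crossWigner (T f) (T g) z * starRingEnd ℂ (crossWigner u v z) = k Ψ

/-- The phase `Φ_I(x,η,t,r) = Φ(x + t/2, η + r/2) - Φ(x - t/2, η - r/2)`. -/
def phaseI {d : ℕ} (Φ : Rd d × Rd d → ℝ) (x η t r : Rd d) : ℝ :=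
  Φ (x + (1 / 2 : ℝ) • t, η + (1 / 2 : ℝ) • r) - Φ (x - (1 / 2 : ℝ) • t, η - (1 / 2 : ℝ) • r)

/-- The symbol `σ_I(x,η,t,r) = σ(x + t/2, η + r/2) conj(σ(x - t/2, η - r/2))`. -/
def symbolI {d : ℕ} (σ : Rd d × Rd d → ℂ) (x η t r : Rd d) : ℂ :=
  σ (x + (1 / 2 : ℝ) • t, η + (1 / 2 : ℝ) • r) *
    starRingEnd ℂ (σ (x - (1 / 2 : ℝ) • t, η - (1 / 2 : ℝ) • r))

/-- The integrand of the pairing of the oscillatory integral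
`k_I(x,ξ,y,η) = ∫∫ e^{2πi[Φ_I(x,η,t,r) - (ξ·t + r·y)]} σ_I(x,η,t,r) dt dr`
with a function `Ψ(x,ξ,y,η)`: the integrations over `ξ` and `y` are carried out first, that is,
`k_I` is the partial Fourier transform, `(t,r) ↦ (ξ,y)`, of the bounded function
`e^{2πi Φ_I} σ_I` in the sense of tempered distributions. The variable is `p = ((x,η),(t,r))`. -/
def kernelPairingIntegrand {d : ℕ} (Φ : Rd d × Rd d → ℝ) (σ : Rd d × Rd d → ℂ)
    (Ψ : (Rd d × Rd d) × (Rd d × Rd d) → ℂ) (p : (Rd d × Rd d) × (Rd d × Rd d)) : ℂ :=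
  Complex.exp (2 * Real.pi * Complex.I * phaseI Φ p.1.1 p.1.2 p.2.1 p.2.2) *
    symbolI σ p.1.1 p.1.2 p.2.1 p.2.2 *
    ∫ q : Rd d × Rd d,
      Complex.exp (-(2 * Real.pi * Complex.I *
        ((inner ℝ q.1 p.2.1 + inner ℝ p.2.2 q.2 : ℝ) : ℂ))) *
      Ψ ((p.1.1, q.1), (q.2, p.1.2))

/-- `k` is the tempered distribution
`k_I(x,ξ,y,η) = ∫∫ e^{2πi[Φ_I(x,η,t,r) - (ξ·t + r·y)]} σ_I(x,η,t,r) dt dr`. -/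
def IsTypeIKernel {d : ℕ} (Φ : Rd d × Rd d → ℝ) (σ : Rd d × Rd d → ℂ)
    (k : 𝓢'((Rd d × Rd d) × (Rd d × Rd d), ℂ)) : Prop :=
  ∀ Ψ : 𝓢((Rd d × Rd d) × (Rd d × Rd d), ℂ),
    Integrable (kernelPairingIntegrand Φ σ Ψ) ∧ k Ψ = ∫ p, kernelPairingIntegrand Φ σ Ψ p

/-- The `t`-integrand of the oscillatory integral
`∫∫ k_I(x,ξ,y,η) F(y,η) dy dη`
`  = ∫∫∫∫ e^{2πi[Φ_I(x,η,t,r) - (ξ·t + r·y)]} σ_I(x,η,t,r) F(y,η) dy dη dr dt`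
at a fixed point `z = (x,ξ)`; the integrations are carried out in the order `y`, `(η,r)`, `t`. -/
def kernelActionIntegrand {d : ℕ} (Φ : Rd d × Rd d → ℝ) (σ : Rd d × Rd d → ℂ)
    (F : Rd d × Rd d → ℂ) (z : Rd d × Rd d) (t : Rd d) : ℂ :=
  Complex.exp (-(2 * Real.pi * Complex.I * (inner ℝ z.2 t : ℝ))) *
    ∫ q : Rd d × Rd d,
      Complex.exp (2 * Real.pi * Complex.I * phaseI Φ z.1 q.1 t q.2) * symbolI σ z.1 q.1 t q.2 *
      ∫ y : Rd d, Complex.exp (-(2 * Real.pi * Complex.I * (inner ℝ q.2 y : ℝ))) * F (y, q.1)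

end

/-! The identity for $W(T_If,T_Ig)$ is algebraic. The Fourier transform of $W(f,g)(\cdot,\eta)$ at
$r$ is $\hat f(\eta+r/2)\overline{\hat g(\eta-r/2)}$ (`integral_osc_mul_crossWigner`). Multiplied by
$e^{2\pi i\Phi_I}\sigma_I$ and integrated in $(\eta,r)$, it decouples under
$(\eta,r)\mapsto(\eta+r/2,\eta-r/2)$, a map of Jacobian one in absolute value, into
$T_If(x+t/2)\overline{T_Ig(x-t/2)}$ (`integral_osc_phaseI`). The Fourier transform in $t$ of this
correlation is $W(T_If,T_Ig)$.

The analysis lies in the convergence. It suffices that $T_If$ decays rapidly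
(`exists_norm_fioTypeI_le`): then the correlation decays rapidly in $t$, uniformly in $x$, which
gives the pointwise formula and justifies Fubini in the weak one. Nonstationary phase in $\xi$ gives
decay in powers of $|\nabla_\eta\Phi(x,0)|$, uniformly in $x$, because the derivatives of $\Phi$ of
order at least two are bounded. This gradient grows at least linearly in $x$: the map
$x\mapsto\nabla_\eta\Phi(x,0)$ has a Lipschitz derivative with uniformly bounded inverses, so by
Hadamard's argument it is a covering of $\mathbb R^d$, hence bijective with Lipschitz inverse.

That $k_I$ is tempered follows because the partial Fourier transform preserves the Schwartz space
and $e^{2\pi i\Phi_I}\sigma_I$ is bounded and continuous. Evaluating $k_I$ on $\Theta\otimes W(f,g)$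
reduces, by the same two formulas, to the pairing of the correlation with a partial Fourier
transform of $\Theta$. -/

/-! ### Hadamard's global inverse function theorem. -/

/-- A map between metric spaces which is open, injective on all balls of a fixed radius and maps
these balls onto sets containing balls of a fixed radius is a covering map. -/
theorem isCoveringMap_of_uniform_local_inverse {E X : Type*} [MetricSpace E] [MetricSpace X]
    {F : E → X} (hF : Continuous F) (hopen : IsOpenMap F) {ρ κ : ℝ} (hκ : 0 < κ)
    (hinj : ∀ x, Set.InjOn F (Metric.ball x ρ))
    (hsurj : ∀ x y, dist y (F x) < κ → ∃ x', dist x' x < ρ ∧ F x' = y) :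
    IsCoveringMap F := by
  intro y
  have hρ : ∀ x : E, 0 < ρ := fun x => by
    obtain ⟨x', h, -⟩ := hsurj x (F x) (by simpa using hκ)
    exact dist_nonneg.trans_lt h
  -- For $u$ within $\kappa$ of $F(x)$, `g x u` is the unique preimage of $u$ within $\rho$ of $x$:
  -- a local inverse whose domain has a size independent of $x$.
  choose! g hg using hsurj
  have hgeq : ∀ x u e, dist u (F x) < κ → dist e x < ρ → F e = u → g x u = e := by
    intro x u e hu he hFe
    exact hinj x (Metric.mem_ball.2 (hg x u hu).1) (Metric.mem_ball.2 he)
      ((hg x u hu).2.trans hFe.symm)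
  have hdisc : DiscreteTopology (F ⁻¹' {y}) := by
    rw [discreteTopology_iff_isOpen_singleton]
    rintro ⟨x, hx⟩
    refine ⟨Metric.ball x ρ, Metric.isOpen_ball, ?_⟩
    ext ⟨z, hz⟩
    simp only [Set.mem_preimage, Set.mem_singleton_iff, Subtype.mk.injEq] at hx hz ⊢
    constructor
    · intro h
      exact hinj x h (Metric.mem_ball_self (hρ x)) (hz.trans hx.symm)
    · rintro rfl
      exact Metric.mem_ball_self (hρ z)
  refine ⟨hdisc, Metric.ball y κ, Metric.mem_ball_self hκ, Metric.isOpen_ball,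
    Metric.isOpen_ball.preimage hF, ?_⟩
  have hU : ∀ e : F ⁻¹' Metric.ball y κ, dist y (F e) < κ := fun e => by
    rw [dist_comm]; exact e.2
  have hV : ∀ (u : Metric.ball y κ) (x : F ⁻¹' {y}), dist u.1 (F x) < κ := fun u x => by
    rw [show F x = y from x.2]; exact u.2
  -- A point $e$ above the ball is labelled by the point of the fibre over $y$ within $\rho$ of it.
  -- The two maps are mutually inverse because "within $\rho$" is symmetric and $F$ is injective on
  -- balls of radius $\rho$.
  refine ⟨{ toFun := fun e => (⟨F e, e.2⟩, ⟨g e y, (hg e y (hU e)).2⟩)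
            invFun := fun p => ⟨g p.2 p.1, by
              rw [Set.mem_preimage, (hg _ _ (hV p.1 p.2)).2]; exact p.1.2⟩
            left_inv := ?_
            right_inv := ?_
            continuous_toFun := ?_
            continuous_invFun := ?_ }, fun _ => rfl⟩
  · intro e
    apply Subtype.ext
    refine hgeq _ _ _ ?_ ?_ rfl
    · rw [(hg _ _ (hU e)).2]; exact e.2
    · rw [dist_comm]; exact (hg _ _ (hU e)).1
  · rintro ⟨u, x⟩
    have h := hg _ _ (hV u x)
    refine Prod.ext (Subtype.ext h.2) (Subtype.ext ?_)
    refine hgeq _ _ _ ?_ ?_ x.2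
    · simp only [h.2]; rw [dist_comm]; exact u.2
    · rw [dist_comm]; exact h.1
  · refine Continuous.prodMk (by fun_prop) ?_
    -- Points close to $e$ are still within $\rho$ of the fibre point labelling $e$, so they carry
    -- the same label.
    refine IsLocallyConstant.continuous ?_
    rw [IsLocallyConstant.iff_eventually_eq]
    intro e
    have : ∀ᶠ e' in nhds e, dist (g e y) e'.1 < ρ := by
      have hc : Continuous fun e' : F ⁻¹' Metric.ball y κ => dist (g e y) e'.1 := by fun_prop
      exact hc.continuousAt.eventually_lt continuousAt_const (hg _ _ (hU e)).1
    filter_upwards [this] with e' he'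
    exact Subtype.ext (hgeq _ _ _ (hU e') he' (hg _ _ (hU e)).2)
  · refine Continuous.subtype_mk ?_ _
    rw [continuous_iff_continuousAt]
    rintro ⟨u, x⟩
    have hdx : ∀ᶠ p : Metric.ball y κ × (F ⁻¹' {y}) in nhds (u, x), p.2 = x :=
      (continuous_snd.continuousAt (x := (u, x))).eventually (p := fun z => z = x)
        (by rw [nhds_discrete]; exact Filter.eventually_pure.2 rfl)
    rw [ContinuousAt, Filter.tendsto_def]
    intro N hN
    obtain ⟨N', hN', hoN, hmem⟩ := mem_nhds_iff.1 hN
    -- With the label frozen at $x$, continuity of the local inverse is openness of $F$.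
    have ho : IsOpen (F '' (N' ∩ Metric.ball x.1 ρ)) := hopen _ (hoN.inter Metric.isOpen_ball)
    have hu : u.1 ∈ F '' (N' ∩ Metric.ball x.1 ρ) :=
      ⟨g x u, ⟨hmem, (hg _ _ (hV u x)).1⟩, (hg _ _ (hV u x)).2⟩
    have hu' : ∀ᶠ p : Metric.ball y κ × (F ⁻¹' {y}) in nhds (u, x),
        p.1.1 ∈ F '' (N' ∩ Metric.ball x.1 ρ) :=
      (by fun_prop : Continuous fun p : Metric.ball y κ × (F ⁻¹' {y}) => p.1.1).continuousAt
        |>.eventually (ho.mem_nhds hu)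
    filter_upwards [hdx, hu'] with p hp hp'
    obtain ⟨e, ⟨heN, heb⟩, hFe⟩ := hp'
    have : g p.2 p.1 = e := hgeq _ _ _ (hV _ _) (by rw [hp]; exact heb) hFe
    rw [Set.mem_preimage, this]
    exact hN' heN

/-- **Hadamard's global inverse function theorem**, quantitative injectivity: a differentiable map
whose derivative is Lipschitz and has uniformly bounded inverses expands distances globally. -/
theorem norm_sub_le_of_hasFDerivAt_equiv {E : Type*} [NormedAddCommGroup E] [NormedSpace ℝ E]
    [CompleteSpace E] {F : E → E} {F' : E → E ≃L[ℝ] E}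
    (hF : ∀ x, HasFDerivAt F (F' x : E →L[ℝ] E) x) {C K : ℝ} (hC0 : 0 < C) (hK0 : 0 < K)
    (hC : ∀ x, ‖((F' x).symm : E →L[ℝ] E)‖ ≤ C)
    (hK : ∀ x y, ‖(F' x : E →L[ℝ] E) - F' y‖ ≤ K * ‖x - y‖) (x y : E) :
    ‖x - y‖ ≤ C * ‖F x - F y‖ := by
  rcases subsingleton_or_nontrivial E with hE | hE
  · rw [Subsingleton.elim x y]; simp
  -- On a ball of radius $\rho$ the derivative varies by at most $K\rho=1/(2C)$, half of the lower
  -- bound $1/C$ for $\|F'(x)^{-1}\|^{-1}$. So $F$ is there a small perturbation of $F'(x)$.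
  set ρ : ℝ := 1 / (2 * K * C) with hρdef
  have hρ : 0 < ρ := by positivity
  set c : NNReal := ⟨1 / (2 * C), by positivity⟩ with hcdef
  have hcont : Continuous F := continuous_iff_continuousAt.2 fun x => (hF x).continuousAt
  have hA : ∀ x, ApproximatesLinearOn F (F' x : E →L[ℝ] E) (Metric.ball x ρ) c := by
    intro x z hz w hw
    refine (convex_ball x ρ).norm_image_sub_le_of_norm_hasFDerivWithin_le'
      (fun v _ => (hF v).hasFDerivWithinAt) (fun v hv => ?_) hw hz
    refine (hK v x).trans ?_
    have : ‖v - x‖ ≤ ρ := by rw [← dist_eq_norm]; exact (Metric.mem_ball.1 hv).le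
    calc K * ‖v - x‖ ≤ K * ρ := by gcongr
      _ = 1 / (2 * C) := by rw [hρdef]; field_simp
  have hN0 : ∀ x, 0 < ‖((F' x).symm : E →L[ℝ] E)‖₊ := fun x => (F' x).nnnorm_symm_pos
  have hNinv : ∀ x, 1 / C ≤ (‖((F' x).symm : E →L[ℝ] E)‖₊ : ℝ)⁻¹ := fun x => by
    rw [one_div]; exact inv_anti₀ (hN0 x) (hC x)
  have hcN : ∀ x, c < ‖((F' x).symm : E →L[ℝ] E)‖₊⁻¹ := fun x => by
    rw [← NNReal.coe_lt_coe, NNReal.coe_inv]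
    refine lt_of_lt_of_le ?_ (hNinv x)
    change 1 / (2 * C) < 1 / C
    apply one_div_lt_one_div_of_lt hC0; linarith
  have hopen : IsOpenMap F := by
    have : ∀ x, Filter.map F (nhds x) = nhds (F x) := fun x => by
      exact (hA x).map_nhds_eq (F' x).toNonlinearRightInverse (Metric.ball_mem_nhds x hρ)
        (Or.inr (hcN x))
    exact isOpenMap_iff_nhds_le.2 fun x => (this x).ge
  have hinj : ∀ x, Set.InjOn F (Metric.ball x ρ) := fun x => (hA x).injOn (Or.inr (hcN x))
  have hcov : IsCoveringMap F := by
    -- The factor in `κ` is $1/C-1/(2C)$, the expansion left after the perturbation. The radius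
    -- $\rho/2$ keeps the preimage strictly inside the ball of radius $\rho$.
    refine isCoveringMap_of_uniform_local_inverse hcont hopen (ρ := ρ)
      (κ := 1 / (2 * C) * (ρ / 2)) (by positivity) hinj fun x y hy => ?_
    have := (hA x).surjOn_closedBall_of_nonlinearRightInverse (F' x).toNonlinearRightInverse
      (ε := ρ / 2) (b := x) (by positivity) (Metric.closedBall_subset_ball (by linarith))
    have hmem : y ∈ Metric.closedBall (F x)
        ((((F' x).toNonlinearRightInverse.nnnorm : ℝ)⁻¹ - c) * (ρ / 2)) := by
      rw [Metric.mem_closedBall]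
      refine hy.le.trans ?_
      gcongr
      have h2 : 1 / (2 * C) = 1 / C - 1 / (2 * C) := by field_simp; norm_num
      rw [h2]
      exact sub_le_sub_right (hNinv x) _
    obtain ⟨x', hx', hFx'⟩ := this hmem
    exact ⟨x', lt_of_le_of_lt hx' (by linarith), hFx'⟩
  -- As $E$ is simply connected, the identity lifts through the covering to a section of $F$.
  -- Uniqueness of lifts then turns the section into a two-sided inverse.
  obtain ⟨s, ⟨hs0, hs⟩, -⟩ := hcov.existsUnique_continuousMap_lifts (ContinuousMap.id E) (F x) x rfl
  have hFs : ∀ z, F (s z) = z := fun z => congrFun hs z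
  have hsF : ∀ z, s (F z) = z := by
    have := hcov.eq_of_comp_eq (g₁ := fun z => s (F z)) (g₂ := id) (by fun_prop) continuous_id
      (by ext z; simp [hFs]) x hs0
    exact fun z => congrFun this z
  have hder : ∀ z, HasFDerivAt s ((F' (s z)).symm : E →L[ℝ] E) z := fun z =>
    (hF (s z)).of_local_left_inverse s.continuous.continuousAt (.of_forall hFs)
  -- The inverse has derivative of norm at most $C$ on all of $E$, so the mean value inequality
  -- gives the global estimate.
  have := Convex.norm_image_sub_le_of_norm_hasFDerivWithin_le (f := s) (s := Set.univ) (C := C)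
    (fun z _ => (hder z).hasFDerivWithinAt) (fun z _ => hC _) convex_univ (Set.mem_univ (F y))
    (Set.mem_univ (F x))
  simpa [hsF] using this

/-! ### Growth of the gradient of a tame phase. -/

/-- Linear maps with bounded norm and determinant bounded below have bounded inverses. -/
theorem exists_norm_symm_le_of_det (d : ℕ) (B : ℝ) {δ : ℝ} (hδ : 0 < δ) :
    ∃ C : ℝ, 0 < C ∧ ∀ M : Matrix (Fin d) (Fin d) ℝ, ‖Matrix.toEuclideanCLM (𝕜 := ℝ) M‖ ≤ B →
      δ ≤ |M.det| → ∃ e : Rd d ≃L[ℝ] Rd d,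
        (e : Rd d →L[ℝ] Rd d) = Matrix.toEuclideanCLM (𝕜 := ℝ) M ∧
        ‖(e.symm : Rd d →L[ℝ] Rd d)‖ ≤ C := by
  set T := Matrix.toEuclideanCLM (𝕜 := ℝ) (n := Fin d) with hT
  have hcont : Continuous fun A : Rd d →L[ℝ] Rd d => ‖T (T.symm A).adjugate‖ := by
    have h1 : Continuous T :=
      LinearMap.continuous_of_finiteDimensional (T.toAlgEquiv.toLinearMap)
    have h2 : Continuous T.symm :=
      LinearMap.continuous_of_finiteDimensional (T.symm.toAlgEquiv.toLinearMap)
    exact (h1.comp (Continuous.matrix_adjugate h2)).norm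
  -- The inverse is the adjugate over the determinant, and the adjugate, being continuous, is
  -- bounded on the compact ball of operators of norm at most $B$.
  obtain ⟨C, hC⟩ := (isCompact_closedBall (0 : Rd d →L[ℝ] Rd d) B).exists_bound_of_continuousOn
    hcont.continuousOn
  refine ⟨δ⁻¹ * |C| + 1, by positivity, fun M hM hdet => ?_⟩
  have hdet0 : M.det ≠ 0 := fun h => by rw [h, abs_zero] at hdet; linarith
  have hmul : T M * T (M.det⁻¹ • M.adjugate) = 1 := by
    rw [← map_mul, Matrix.mul_smul, Matrix.mul_adjugate, smul_smul, inv_mul_cancel₀ hdet0, one_smul,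
      map_one]
  have hmul' : T (M.det⁻¹ • M.adjugate) * T M = 1 := by
    rw [← map_mul, Matrix.smul_mul, Matrix.adjugate_mul, smul_smul, inv_mul_cancel₀ hdet0, one_smul,
      map_one]
  refine ⟨ContinuousLinearEquiv.equivOfInverse (T M) (T (M.det⁻¹ • M.adjugate))
    (fun v => congrArg (fun A : Rd d →L[ℝ] Rd d => A v) hmul')
    (fun v => congrArg (fun A : Rd d →L[ℝ] Rd d => A v) hmul), rfl, ?_⟩
  change ‖T (M.det⁻¹ • M.adjugate)‖ ≤ _
  rw [map_smul, norm_smul, norm_inv, Real.norm_eq_abs]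
  have h1 : ‖T M.adjugate‖ ≤ |C| := by
    have := hC (T M) (by simpa using hM)
    simp only [StarAlgEquiv.symm_apply_apply, norm_norm] at this
    exact this.trans (le_abs_self C)
  have h2 : |M.det|⁻¹ ≤ δ⁻¹ := inv_anti₀ hδ hdet
  calc |M.det|⁻¹ * ‖T M.adjugate‖ ≤ δ⁻¹ * |C| := by gcongr
    _ ≤ _ := by linarith

/-- The Riesz representation of functionals on `ℝ^d`. -/
noncomputable def rieszRep (d : ℕ) : StrongDual ℝ (Rd d) →L[ℝ] Rd d :=
  LinearMap.toContinuousLinearMap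
    { toFun := (InnerProductSpace.toDual ℝ (Rd d)).symm
      map_add' := map_add _
      map_smul' := fun c v => by simp }

theorem inner_rieszRep {d : ℕ} (f : StrongDual ℝ (Rd d)) (w : Rd d) :
    inner ℝ (rieszRep d f) w = f w :=
  InnerProductSpace.toDual_symm_apply

/-- The gradient of `Φ` in its second variable. -/
noncomputable def gradSnd {d : ℕ} (Φ : Rd d × Rd d → ℝ) (z : Rd d × Rd d) : Rd d :=
  rieszRep d ((fderiv ℝ Φ z).comp (ContinuousLinearMap.inr ℝ (Rd d) (Rd d)))

theorem inner_gradSnd {d : ℕ} (Φ : Rd d × Rd d → ℝ) (z : Rd d × Rd d) (w : Rd d) :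
    inner ℝ (gradSnd Φ z) w = fderiv ℝ Φ z (0, w) := by
  rw [gradSnd, inner_rieszRep]
  simp

/-- The mixed part of a bilinear form on `ℝ^d × ℝ^d`, as an operator. -/
noncomputable def mixedPart {d : ℕ} (D : Rd d × Rd d →L[ℝ] Rd d × Rd d →L[ℝ] ℝ) :
    Rd d →L[ℝ] Rd d :=
  (rieszRep d).comp
    (((ContinuousLinearMap.compL ℝ (Rd d) (Rd d × Rd d) ℝ).flip
      (ContinuousLinearMap.inr ℝ (Rd d) (Rd d))).comp
      (D.comp (ContinuousLinearMap.inl ℝ (Rd d) (Rd d))))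

theorem inner_mixedPart {d : ℕ} (D : Rd d × Rd d →L[ℝ] Rd d × Rd d →L[ℝ] ℝ) (v w : Rd d) :
    inner ℝ (mixedPart D v) w = D (v, 0) (0, w) := by
  simp [mixedPart, inner_rieszRep]

theorem mixedPart_sub {d : ℕ} (D D' : Rd d × Rd d →L[ℝ] Rd d × Rd d →L[ℝ] ℝ) :
    mixedPart (D - D') = mixedPart D - mixedPart D' := by
  ext1 v
  refine ext_inner_right ℝ fun w => ?_
  simp [inner_mixedPart, inner_sub_left]

theorem norm_mixedPart_le {d : ℕ} (D : Rd d × Rd d →L[ℝ] Rd d × Rd d →L[ℝ] ℝ) :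
    ‖mixedPart D‖ ≤ ‖D‖ := by
  refine ContinuousLinearMap.opNorm_le_bound _ (ContinuousLinearMap.opNorm_nonneg D) fun v => ?_
  set u := mixedPart D v with hu
  have h : ‖u‖ * ‖u‖ ≤ ‖D‖ * ‖v‖ * ‖u‖ := by
    rw [← real_inner_self_eq_norm_mul_norm]
    have : inner ℝ u u = D (v, 0) (0, u) := by
      conv_lhs => rw [hu]
      rw [inner_mixedPart]
    rw [this]
    have h3 := (D (v, 0)).le_opNorm (0, u)
    have h4 := D.le_opNorm (v, 0)
    simp only [Prod.norm_mk, norm_zero, norm_nonneg, sup_of_le_left, sup_of_le_right] at h3 h4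
    exact (Real.le_norm_self _).trans (h3.trans (by gcongr))
  rcases eq_or_lt_of_le (norm_nonneg u) with h0 | h0
  · rw [← h0]; exact mul_nonneg (ContinuousLinearMap.opNorm_nonneg D) (norm_nonneg v)
  · exact le_of_mul_le_mul_right h h0

theorem norm_fderiv_fderiv_le {E F : Type*} [NormedAddCommGroup E] [NormedSpace ℝ E]
    [NormedAddCommGroup F] [NormedSpace ℝ F] {f : E → F} {C : ℝ}
    (hC : ∀ z, ‖iteratedFDeriv ℝ 2 f z‖ ≤ C) (z : E) : ‖fderiv ℝ (fderiv ℝ f) z‖ ≤ C := by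
  have := hC z
  rwa [← norm_iteratedFDeriv_fderiv, ← norm_iteratedFDeriv_fderiv, norm_iteratedFDeriv_zero] at this

set_option maxSynthPendingDepth 3 in
theorem norm_fderiv_fderiv_sub_le {E F : Type*} [NormedAddCommGroup E] [NormedSpace ℝ E]
    [NormedAddCommGroup F] [NormedSpace ℝ F] {f : E → F} (hf : ContDiff ℝ ∞ f) {C : ℝ}
    (hC : ∀ z, ‖iteratedFDeriv ℝ 3 f z‖ ≤ C) (z z' : E) :
    ‖fderiv ℝ (fderiv ℝ f) z - fderiv ℝ (fderiv ℝ f) z'‖ ≤ C * ‖z - z'‖ := by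
  have h3 : ∀ z, ‖fderiv ℝ (fderiv ℝ (fderiv ℝ f)) z‖ ≤ C := fun z => by
    have := hC z
    rwa [← norm_iteratedFDeriv_fderiv, ← norm_iteratedFDeriv_fderiv, ← norm_iteratedFDeriv_fderiv,
      norm_iteratedFDeriv_zero] at this
  have hdiff : Differentiable ℝ (fderiv ℝ (fderiv ℝ f)) :=
    ((hf.fderiv_right (m := 2) (by norm_cast)).fderiv_right (m := 1)
      (by norm_num)).differentiable one_ne_zero
  exact Convex.norm_image_sub_le_of_norm_fderiv_le (𝕜 := ℝ) (fun w _ => hdiff w)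
      (fun w _ => h3 w) convex_univ (Set.mem_univ _) (Set.mem_univ _)

/-- The transpose appears because rows of the mixed Hessian are indexed by $x$, whereas the
derivative of $x\mapsto\nabla_\eta\Phi$ takes $x$-vectors to $\eta$-vectors. This carries the
determinant bound over to that derivative. -/
theorem toEuclideanCLM_mixedHessian_transpose {d : ℕ} (Φ : Rd d × Rd d → ℝ) (z : Rd d × Rd d) :
    Matrix.toEuclideanCLM (𝕜 := ℝ) (mixedHessian Φ z).transpose = mixedPart (fderiv ℝ (fderiv ℝ Φ) z) := by
  ext v j
  have h : v = ∑ i, v i • EuclideanSpace.single i (1 : ℝ) := by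
    ext k
    simp [Finset.sum_apply, Pi.single_apply]
  have h2 : mixedPart (fderiv ℝ (fderiv ℝ Φ) z) v j = inner ℝ (mixedPart (fderiv ℝ (fderiv ℝ Φ) z) v) (EuclideanSpace.single j 1) := by
    simp [EuclideanSpace.inner_single_right]
  rw [h2]
  conv_rhs => rw [h]
  rw [map_sum, sum_inner]
  simp_rw [map_smul, inner_smul_left, inner_mixedPart]
  have : (Matrix.toEuclideanCLM (𝕜 := ℝ) (mixedHessian Φ z).transpose) v =
      WithLp.toLp 2 ((mixedHessian Φ z).transpose.mulVec v.ofLp) := by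
    rw [← Matrix.toEuclideanCLM_toLp]
  rw [this]
  simp [Matrix.mulVec, dotProduct, mixedHessian, mul_comm]

theorem hasFDerivAt_gradSnd {d : ℕ} {Φ : Rd d × Rd d → ℝ} (hΦ : ContDiff ℝ ∞ Φ) (x : Rd d) :
    HasFDerivAt (fun x => gradSnd Φ (x, 0)) (mixedPart (fderiv ℝ (fderiv ℝ Φ) (x, 0))) x := by
  have h1 : HasFDerivAt (fderiv ℝ Φ) (fderiv ℝ (fderiv ℝ Φ) (x, 0)) (x, 0) :=
    ((hΦ.fderiv_right (m := 1) (by norm_cast)).differentiable one_ne_zero).differentiableAt.hasFDerivAt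
  have h2 : HasFDerivAt (fun x : Rd d => fderiv ℝ Φ (x, 0))
      ((fderiv ℝ (fderiv ℝ Φ) (x, 0)).comp (ContinuousLinearMap.inl ℝ (Rd d) (Rd d))) x :=
    h1.comp x (ContinuousLinearMap.inl ℝ (Rd d) (Rd d)).hasFDerivAt
  exact (rieszRep d).hasFDerivAt.comp x
    ((((ContinuousLinearMap.compL ℝ (Rd d) (Rd d × Rd d) ℝ).flip
      (ContinuousLinearMap.inr ℝ (Rd d) (Rd d)))).hasFDerivAt.comp x h2)

/-- For a tame phase, `x ↦ ∇_η Φ(x, 0)` grows at least linearly. -/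
theorem IsTamePhase.norm_le_gradSnd {d : ℕ} {Φ : Rd d × Rd d → ℝ} (hΦ : IsTamePhase Φ) :
    ∃ C : ℝ, 0 < C ∧ ∀ x, ‖x‖ ≤ C * (1 + ‖gradSnd Φ (x, 0)‖) := by
  obtain ⟨δ, hδ, hdet⟩ := hΦ.nondegenerate
  obtain ⟨C2, hC2⟩ := hΦ.bounded_deriv 2 le_rfl
  obtain ⟨C3, hC3⟩ := hΦ.bounded_deriv 3 (by norm_num)
  obtain ⟨C, hC, he⟩ := exists_norm_symm_le_of_det d C2 hδ
  have he' : ∀ x : Rd d, ∃ e : Rd d ≃L[ℝ] Rd d, (e : Rd d →L[ℝ] Rd d) = mixedPart (fderiv ℝ (fderiv ℝ Φ) (x, 0)) ∧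
      ‖(e.symm : Rd d →L[ℝ] Rd d)‖ ≤ C := fun x => by
    have := he (mixedHessian Φ (x, 0)).transpose
    rw [toEuclideanCLM_mixedHessian_transpose, Matrix.det_transpose] at this
    exact this ((norm_mixedPart_le _).trans (norm_fderiv_fderiv_le hC2 _)) (hdet _)
  choose e hee hes using he'
  have key := norm_sub_le_of_hasFDerivAt_equiv (F := fun x => gradSnd Φ (x, 0)) (F' := e)
    (fun x => by rw [hee]; exact hasFDerivAt_gradSnd hΦ.smooth x) hC
    (K := |C3| + 1) (by positivity) hes (fun x y => by
      rw [hee, hee, ← mixedPart_sub]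
      refine (norm_mixedPart_le _).trans
        ((norm_fderiv_fderiv_sub_le hΦ.smooth hC3 _ _).trans ?_)
      have : ‖((x, 0) : Rd d × Rd d) - (y, 0)‖ = ‖x - y‖ := by simp [Prod.norm_def]
      rw [this]
      have := le_abs_self C3
      gcongr
      linarith)
  -- The expansion estimate is applied to $x$ and $0$, and the value of the gradient at the origin
  -- goes into the constant.
  refine ⟨C * (1 + ‖gradSnd Φ (0, 0)‖), by positivity, fun x => ?_⟩
  have h := key x 0
  rw [sub_zero] at h
  have h' := norm_sub_le (gradSnd Φ (x, 0)) (gradSnd Φ (0, 0))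
  set a := ‖gradSnd Φ (x, 0)‖
  set b := ‖gradSnd Φ (0, 0)‖
  have ha : 0 ≤ a := norm_nonneg _
  have hb : 0 ≤ b := norm_nonneg _
  calc ‖x‖ ≤ C * (a + b) := h.trans (by gcongr)
    _ ≤ C * (1 + b) * (1 + a) := by
      rw [mul_assoc]; gcongr; nlinarith [mul_nonneg ha hb]

/-! ### Nonstationary phase, uniformly in a parameter. -/

/-- Restricting a function on a product to a slice does not increase its derivatives. -/
theorem norm_iteratedFDeriv_slice_le {E V F : Type*} [NormedAddCommGroup E] [NormedSpace ℝ E]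
    [NormedAddCommGroup V] [NormedSpace ℝ V] [NormedAddCommGroup F] [NormedSpace ℝ F]
    {G : E × V → F} (hG : ContDiff ℝ ∞ G) (n : ℕ) (x : E) (v : V) :
    ‖iteratedFDeriv ℝ n (fun v => G (x, v)) v‖ ≤ ‖iteratedFDeriv ℝ n G (x, v)‖ := by
  have h1 : (fun v => G (x, v)) =
      (fun z => G ((x, 0) + z)) ∘ (ContinuousLinearMap.inr ℝ E V) := by
    ext v; simp
  have h2 : ContDiff ℝ ∞ fun z : E × V => G ((x, 0) + z) := hG.comp (by fun_prop)
  rw [h1, ContinuousLinearMap.iteratedFDeriv_comp_right _ h2 _ (i := n) (by exact_mod_cast le_top),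
    iteratedFDeriv_comp_add_left]
  refine (ContinuousMultilinearMap.norm_compContinuousLinearMap_le _ _).trans ?_
  have h3 : ∏ _i : Fin n, ‖ContinuousLinearMap.inr ℝ E V‖ ≤ 1 :=
    Finset.prod_le_one (fun _ _ => norm_nonneg _)
      fun _ _ => ContinuousLinearMap.norm_inr_le_one ℝ E V
  have h4 : ((x, 0) : E × V) + (ContinuousLinearMap.inr ℝ E V) v = (x, v) := by simp
  rw [h4]
  exact mul_le_of_le_one_right (norm_nonneg _) h3

section families

variable {X V : Type*} [NormedAddCommGroup V] [NormedSpace ℝ V]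

/-- A family of functions which are Schwartz functions, uniformly in the parameter. -/
structure UniformlySchwartz (a : X → V → ℂ) : Prop where
  smooth : ∀ x, ContDiff ℝ ∞ (a x)
  decay : ∀ k n : ℕ, ∃ C : ℝ, ∀ x v, ‖v‖ ^ k * ‖iteratedFDeriv ℝ n (a x) v‖ ≤ C

/-- A family of functions which are of temperate growth, uniformly in the parameter. -/
structure UniformlyTemperate (m : X → V → ℂ) : Prop where
  smooth : ∀ x, ContDiff ℝ ∞ (m x)
  growth : ∀ n : ℕ, ∃ (k : ℕ) (C : ℝ), 0 ≤ C ∧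
    ∀ x v, ‖iteratedFDeriv ℝ n (m x) v‖ ≤ C * (1 + ‖v‖) ^ k

theorem UniformlySchwartz.one_add_decay {a : X → V → ℂ} (ha : UniformlySchwartz a) (k n : ℕ) :
    ∃ C : ℝ, 0 ≤ C ∧ ∀ x v, (1 + ‖v‖) ^ k * ‖iteratedFDeriv ℝ n (a x) v‖ ≤ C := by
  obtain ⟨C0, h0⟩ := ha.decay 0 n
  obtain ⟨C1, h1⟩ := ha.decay k n
  refine ⟨2 ^ k * (|C0| + |C1|), by positivity, fun x v => ?_⟩
  have hb : (1 + ‖v‖) ^ k ≤ 2 ^ k * (1 + ‖v‖ ^ k) := by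
    have h := add_pow_le (zero_le_one' ℝ) (norm_nonneg v) k
    rw [one_pow] at h
    refine h.trans ?_
    gcongr
    · norm_num
    · omega
  have h0' := (h0 x v).trans (le_abs_self _)
  have h1' := (h1 x v).trans (le_abs_self _)
  rw [pow_zero, one_mul] at h0'
  calc (1 + ‖v‖) ^ k * ‖iteratedFDeriv ℝ n (a x) v‖
      ≤ 2 ^ k * (1 + ‖v‖ ^ k) * ‖iteratedFDeriv ℝ n (a x) v‖ := by gcongr
    _ = 2 ^ k * (‖iteratedFDeriv ℝ n (a x) v‖ + ‖v‖ ^ k * ‖iteratedFDeriv ℝ n (a x) v‖) := by ring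
    _ ≤ _ := by gcongr

theorem UniformlyTemperate.mul_uniformlySchwartz {m a : X → V → ℂ} (hm : UniformlyTemperate m)
    (ha : UniformlySchwartz a) : UniformlySchwartz fun x v => m x v * a x v := by
  refine ⟨fun x => (hm.smooth x).mul (ha.smooth x), fun k n => ?_⟩
  choose l C hC0 hC using hm.growth
  choose D hD0 hD using fun k n => ha.one_add_decay k n
  refine ⟨∑ i ∈ Finset.range (n + 1), (n.choose i) * C i * D (k + l i) (n - i), fun x v => ?_⟩
  have h := norm_iteratedFDeriv_mul_le (hm.smooth x) (ha.smooth x) v (n := n)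
    (by exact_mod_cast le_top)
  calc ‖v‖ ^ k * ‖iteratedFDeriv ℝ n (fun v => m x v * a x v) v‖
      ≤ ‖v‖ ^ k * ∑ i ∈ Finset.range (n + 1), (n.choose i) * ‖iteratedFDeriv ℝ i (m x) v‖ *
          ‖iteratedFDeriv ℝ (n - i) (a x) v‖ := by gcongr
    _ = ∑ i ∈ Finset.range (n + 1), ‖v‖ ^ k * ((n.choose i) * ‖iteratedFDeriv ℝ i (m x) v‖ *
          ‖iteratedFDeriv ℝ (n - i) (a x) v‖) := Finset.mul_sum _ _ _
    _ ≤ _ := by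
      refine Finset.sum_le_sum fun i _ => ?_
      calc ‖v‖ ^ k * ((n.choose i) * ‖iteratedFDeriv ℝ i (m x) v‖ *
            ‖iteratedFDeriv ℝ (n - i) (a x) v‖)
          ≤ (1 + ‖v‖) ^ k * ((n.choose i) * (C i * (1 + ‖v‖) ^ l i) *
            ‖iteratedFDeriv ℝ (n - i) (a x) v‖) := by
            gcongr
            · linarith
            · exact hC i x v
        _ = (n.choose i) * C i * ((1 + ‖v‖) ^ (k + l i) * ‖iteratedFDeriv ℝ (n - i) (a x) v‖) := by
            rw [pow_add]; ring
        _ ≤ _ := by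
            have := hD (k + l i) (n - i) x v
            have := hC0 i
            gcongr

theorem UniformlySchwartz.sub {a b : X → V → ℂ} (ha : UniformlySchwartz a)
    (hb : UniformlySchwartz b) : UniformlySchwartz fun x v => a x v - b x v := by
  refine ⟨fun x => (ha.smooth x).sub (hb.smooth x), fun k n => ?_⟩
  obtain ⟨C, hC⟩ := ha.decay k n
  obtain ⟨D, hD⟩ := hb.decay k n
  refine ⟨C + D, fun x v => ?_⟩
  have h : iteratedFDeriv ℝ n (fun v => a x v - b x v) =
      iteratedFDeriv ℝ n (a x) - iteratedFDeriv ℝ n (b x) :=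
    iteratedFDeriv_sub ((ha.smooth x).of_le (by exact_mod_cast le_top))
      ((hb.smooth x).of_le (by exact_mod_cast le_top))
  rw [h]
  calc ‖v‖ ^ k * ‖iteratedFDeriv ℝ n (a x) v - iteratedFDeriv ℝ n (b x) v‖
      ≤ ‖v‖ ^ k * (‖iteratedFDeriv ℝ n (a x) v‖ + ‖iteratedFDeriv ℝ n (b x) v‖) := by
        gcongr; exact norm_sub_le _ _
    _ ≤ C + D := by rw [mul_add]; exact add_le_add (hC x v) (hD x v)

theorem UniformlySchwartz.const_mul {a : X → V → ℂ} (ha : UniformlySchwartz a) (c : ℂ) :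
    UniformlySchwartz fun x v => c * a x v := by
  refine UniformlyTemperate.mul_uniformlySchwartz (m := fun _ _ => c)
    ⟨fun _ => contDiff_const, fun n => ⟨0, ‖c‖, norm_nonneg _, fun _ v => ?_⟩⟩ ha
  rcases n with _ | n
  · simp
  · simp [iteratedFDeriv_succ_const]

theorem norm_iteratedFDeriv_fderiv_apply_le {F : Type*} [NormedAddCommGroup F] [NormedSpace ℝ F]
    {f : V → F} (hf : ContDiff ℝ ∞ f) (n : ℕ) {ν : V} (hν : ‖ν‖ ≤ 1) (v : V) :
    ‖iteratedFDeriv ℝ n (fun v => fderiv ℝ f v ν) v‖ ≤ ‖iteratedFDeriv ℝ (n + 1) f v‖ := by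
  have h : ContDiff ℝ ∞ (fderiv ℝ f) := hf.fderiv_right (by norm_cast)
  refine (norm_iteratedFDeriv_clm_apply_const h.contDiffAt
    (by exact_mod_cast le_top : (n : WithTop ℕ∞) ≤ ∞)).trans ?_
  rw [norm_iteratedFDeriv_fderiv]
  exact mul_le_of_le_one_left (norm_nonneg _) hν

theorem UniformlySchwartz.fderiv_apply {a : X → V → ℂ} (ha : UniformlySchwartz a) {ν : X → V}
    (hν : ∀ x, ‖ν x‖ ≤ 1) : UniformlySchwartz fun x v => fderiv ℝ (a x) v (ν x) := by
  refine ⟨fun x => ((ha.smooth x).fderiv_right (m := ∞) (by norm_cast)).clm_apply contDiff_const,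
    fun k n => ?_⟩
  obtain ⟨C, hC⟩ := ha.decay k (n + 1)
  refine ⟨C, fun x v => le_trans ?_ (hC x v)⟩
  gcongr
  exact norm_iteratedFDeriv_fderiv_apply_le (ha.smooth x) n (hν x) v

theorem UniformlySchwartz.integrable [FiniteDimensional ℝ V] [MeasurableSpace V] [BorelSpace V]
    (μ : Measure V) [μ.IsAddHaarMeasure] {a : X → V → ℂ} (ha : UniformlySchwartz a) :
    (∀ x, Integrable (a x) μ) ∧ ∃ C : ℝ, ∀ x, ∫ v, ‖a x v‖ ∂μ ≤ C := by
  obtain ⟨C, hC0, hC⟩ := ha.one_add_decay μ.integrablePower 0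
  have hI := (μ.integrable_pow_neg_integrablePower).const_mul C
  have hle : ∀ x v, ‖a x v‖ ≤ C * (1 + ‖v‖) ^ (-(μ.integrablePower : ℝ)) := fun x v => by
    have h := hC x v
    rw [norm_iteratedFDeriv_zero] at h
    have hp : 0 < 1 + ‖v‖ := by positivity
    rw [Real.rpow_neg hp.le, Real.rpow_natCast, ← div_eq_mul_inv, le_div_iff₀ (by positivity),
      mul_comm]
    exact h
  have hint : ∀ x, Integrable (a x) μ := fun x =>
    hI.mono' (ha.smooth x).continuous.aestronglyMeasurable (.of_forall (hle x))
  exact ⟨hint, _, fun x => integral_mono (hint x).norm hI (hle x)⟩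

/-- The increment of a directional derivative of a phase with bounded derivatives of order at least
two. -/
theorem uniformlyTemperate_fderiv_sub {φ : X → V → ℝ} (hφ : ∀ x, ContDiff ℝ ∞ (φ x))
    (hb : ∀ n : ℕ, 2 ≤ n → ∃ C : ℝ, ∀ x v, ‖iteratedFDeriv ℝ n (φ x) v‖ ≤ C)
    {ν : X → V} (hν : ∀ x, ‖ν x‖ ≤ 1) :
    UniformlyTemperate fun x v => ((fderiv ℝ (φ x) v (ν x) - fderiv ℝ (φ x) 0 (ν x) : ℝ) : ℂ) := by
  have hs : ∀ x, ContDiff ℝ ∞ fun v => fderiv ℝ (φ x) v (ν x) - fderiv ℝ (φ x) 0 (ν x) := fun x =>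
    (((hφ x).fderiv_right (m := ∞) (by norm_cast)).clm_apply contDiff_const).sub contDiff_const
  have hnorm : ∀ x (n : ℕ) v,
      ‖iteratedFDeriv ℝ n
        (fun v => ((fderiv ℝ (φ x) v (ν x) - fderiv ℝ (φ x) 0 (ν x) : ℝ) : ℂ)) v‖ =
      ‖iteratedFDeriv ℝ n (fun v => fderiv ℝ (φ x) v (ν x) - fderiv ℝ (φ x) 0 (ν x)) v‖ :=
    fun x n v => Complex.ofRealLI.norm_iteratedFDeriv_comp_left
      ((hs x).contDiffAt (x := v)) (i := n) (by exact_mod_cast le_top)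
  refine ⟨fun x => Complex.ofRealCLM.contDiff.comp (hs x), fun n => ?_⟩
  simp_rw [hnorm]
  rcases n with _ | n
  -- The first derivative of the phase need not be bounded in the parameter, but its increment from
  -- the origin grows at most linearly, by the bound on second derivatives.
  · obtain ⟨C, hC⟩ := hb 2 le_rfl
    refine ⟨1, |C|, abs_nonneg _, fun x v => ?_⟩
    rw [norm_iteratedFDeriv_zero, pow_one]
    have hdiff : Differentiable ℝ (fderiv ℝ (φ x)) :=
      ((hφ x).fderiv_right (m := 1) (by norm_cast)).differentiable one_ne_zero
    have h := Convex.norm_image_sub_le_of_norm_fderiv_le (𝕜 := ℝ) (fun w _ => hdiff w)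
      (fun w _ => norm_fderiv_fderiv_le (hC x) w) convex_univ (Set.mem_univ (0 : V))
      (Set.mem_univ v)
    rw [sub_zero] at h
    rw [← _root_.sub_apply]
    calc _ ≤ ‖fderiv ℝ (φ x) v - fderiv ℝ (φ x) 0‖ * ‖ν x‖ := ContinuousLinearMap.le_opNorm _ _
      _ ≤ C * ‖v‖ := (mul_le_of_le_one_right (norm_nonneg _) (hν x)).trans h
      _ ≤ |C| * (1 + ‖v‖) := by
        gcongr
        · exact le_abs_self C
        · linarith
  · obtain ⟨C, hC⟩ := hb (n + 2) (by omega)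
    refine ⟨0, |C|, abs_nonneg _, fun x v => ?_⟩
    have h : iteratedFDeriv ℝ (n + 1) (fun v => fderiv ℝ (φ x) v (ν x) - fderiv ℝ (φ x) 0 (ν x)) =
        iteratedFDeriv ℝ (n + 1) (fun v => fderiv ℝ (φ x) v (ν x)) -
        iteratedFDeriv ℝ (n + 1) (fun _ : V => fderiv ℝ (φ x) 0 (ν x)) :=
      iteratedFDeriv_sub ((((hφ x).fderiv_right (m := ∞) (by norm_cast)).clm_apply
        contDiff_const).of_le (by exact_mod_cast le_top)) contDiff_const
    rw [h, iteratedFDeriv_succ_const, sub_zero, pow_zero, mul_one]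
    exact (norm_iteratedFDeriv_fderiv_apply_le (hφ x) (n + 1) (hν x) v).trans
      ((hC x v).trans (le_abs_self C))

/-- The oscillating factor `e^{2πi s}`. -/
noncomputable def osc (s : ℝ) : ℂ := Complex.exp (2 * Real.pi * Complex.I * s)

theorem norm_osc (s : ℝ) : ‖osc s‖ = 1 := by
  have : (2 * Real.pi * Complex.I * s : ℂ) = ((2 * Real.pi * s : ℝ) : ℂ) * Complex.I := by
    push_cast; ring
  rw [osc, this, Complex.norm_exp_ofReal_mul_I]

theorem continuous_osc : Continuous osc := by unfold osc; fun_prop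

theorem hasFDerivAt_osc_comp {φ : V → ℝ} {φ' : V →L[ℝ] ℝ} {v : V} (h : HasFDerivAt φ φ' v) :
    HasFDerivAt (fun v => osc (φ v))
      ((2 * Real.pi * Complex.I * osc (φ v)) • (Complex.ofRealCLM.comp φ')) v := by
  have h1 : HasFDerivAt (fun v => (2 * Real.pi * Complex.I * (φ v : ℂ)))
      ((2 * Real.pi * Complex.I) • (Complex.ofRealCLM.comp φ')) v :=
    (Complex.ofRealCLM.hasFDerivAt.comp v h).const_mul _
  have h2 := h1.cexp
  rw [smul_smul] at h2
  convert! h2 using 2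
  rw [osc]; ring

/-- **Nonstationary phase**: oscillatory integrals whose phases have derivatives of order at least
two bounded decay rapidly in the size of a directional derivative of the phase at the origin. -/
theorem exists_pow_mul_norm_integral_osc_le [FiniteDimensional ℝ V] [MeasurableSpace V]
    [BorelSpace V] (μ : Measure V) [μ.IsAddHaarMeasure] {φ : X → V → ℝ}
    (hφ : ∀ x, ContDiff ℝ ∞ (φ x))
    (hb : ∀ n : ℕ, 2 ≤ n → ∃ C : ℝ, ∀ x v, ‖iteratedFDeriv ℝ n (φ x) v‖ ≤ C)
    {ν : X → V} (hν : ∀ x, ‖ν x‖ ≤ 1) (N : ℕ) {a : X → V → ℂ} (ha : UniformlySchwartz a) :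
    ∃ C : ℝ, ∀ x, |fderiv ℝ (φ x) 0 (ν x)| ^ N * ‖∫ v, osc (φ x v) * a x v ∂μ‖ ≤ C := by
  induction N generalizing a with
  | zero =>
    obtain ⟨-, C, hC⟩ := ha.integrable μ
    refine ⟨C, fun x => ?_⟩
    rw [pow_zero, one_mul]
    refine (norm_integral_le_integral_norm _).trans (le_of_eq_of_le ?_ (hC x))
    simp_rw [norm_mul, norm_osc, one_mul]
  | succ N ih =>
    -- Writing $\partial_\nu\varphi=l+(\partial_\nu\varphi-l)$ with $l$ the value at the origin, one
    -- integration by parts trades a factor $l$ for the amplitude $-(2\pi i)^{-1}\partial_\nu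
    -- a-(\partial_\nu\varphi-l)a$. This is again uniformly Schwartz, so the induction hypothesis
    -- applies to it.
    have hr := (uniformlyTemperate_fderiv_sub hφ hb hν).mul_uniformlySchwartz ha
    have hd := ha.fderiv_apply hν
    obtain ⟨C, hC⟩ := ih ((hd.const_mul (-(2 * Real.pi * Complex.I)⁻¹)).sub hr)
    refine ⟨C, fun x => ?_⟩
    set l : ℝ := fderiv ℝ (φ x) 0 (ν x) with hl
    have hoscI : ∀ {g : V → ℂ}, Integrable g μ → Integrable (fun v => osc (φ x v) * g v) μ := by
      intro g hg
      refine hg.bdd_mul (c := 1) ?_ (.of_forall fun v => (norm_osc _).le)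
      exact (continuous_osc.comp (hφ x).continuous).aestronglyMeasurable
    have hIa := (ha.integrable μ).1 x
    have hId := (hd.integrable μ).1 x
    have hIr := (hr.integrable μ).1 x
    have hdosc : ∀ v, fderiv ℝ (fun v => osc (φ x v)) v (ν x) =
        2 * Real.pi * Complex.I * osc (φ x v) * (fderiv ℝ (φ x) v (ν x) : ℂ) := fun v => by
      rw [(hasFDerivAt_osc_comp
        ((hφ x).differentiable (by simp)).differentiableAt.hasFDerivAt).fderiv]
      simp
    have hpi : (2 * Real.pi * Complex.I : ℂ) ≠ 0 := by simp [Real.pi_ne_zero]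
    have hsplit : ∀ v, fderiv ℝ (fun v => osc (φ x v)) v (ν x) * a x v =
        (2 * Real.pi * Complex.I) * (l * (osc (φ x v) * a x v)) +
        (2 * Real.pi * Complex.I) * (osc (φ x v) *
          (((fderiv ℝ (φ x) v (ν x) - l : ℝ) : ℂ) * a x v)) := fun v => by
      rw [hdosc]; push_cast; ring
    have hI1 : Integrable (fun v => (2 * Real.pi * Complex.I) * (l * (osc (φ x v) * a x v))) μ :=
      ((hoscI hIa).const_mul _).const_mul _
    have hI2 : Integrable (fun v => (2 * Real.pi * Complex.I) * (osc (φ x v) *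
          (((fderiv ℝ (φ x) v (ν x) - l : ℝ) : ℂ) * a x v))) μ := (hoscI hIr).const_mul _
    have hibp := integral_mul_fderiv_eq_neg_fderiv_mul_of_integrable (μ := μ)
      (f := fun v => osc (φ x v)) (g := a x) (v := ν x)
      ((hI1.add hI2).congr (.of_forall fun v => (hsplit v).symm)) (hoscI hId) (hoscI hIa)
      (fun v _ => (hasFDerivAt_osc_comp
        ((hφ x).differentiable (by simp)).differentiableAt.hasFDerivAt).differentiableAt)
      (fun v _ => ((ha.smooth x).differentiable (by simp)).differentiableAt)
    simp_rw [hsplit] at hibp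
    rw [integral_add hI1 hI2, integral_const_mul, integral_const_mul, integral_const_mul] at hibp
    have hkey : (l : ℂ) * ∫ v, osc (φ x v) * a x v ∂μ =
        ∫ v, osc (φ x v) * (-(2 * Real.pi * Complex.I)⁻¹ * fderiv ℝ (a x) v (ν x) -
          ((fderiv ℝ (φ x) v (ν x) - l : ℝ) : ℂ) * a x v) ∂μ := by
      have h1 : ∀ v, osc (φ x v) * (-(2 * Real.pi * Complex.I)⁻¹ * fderiv ℝ (a x) v (ν x) -
          ((fderiv ℝ (φ x) v (ν x) - l : ℝ) : ℂ) * a x v) =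
          -(2 * Real.pi * Complex.I)⁻¹ * (osc (φ x v) * fderiv ℝ (a x) v (ν x)) -
          osc (φ x v) * (((fderiv ℝ (φ x) v (ν x) - l : ℝ) : ℂ) * a x v) := fun v => by ring
      simp_rw [h1]
      rw [integral_sub ((hoscI hId).const_mul _) (hoscI hIr), integral_const_mul, hibp]
      field_simp
      ring
    calc |l| ^ (N + 1) * ‖∫ v, osc (φ x v) * a x v ∂μ‖
        = |l| ^ N * ‖(l : ℂ) * ∫ v, osc (φ x v) * a x v ∂μ‖ := by
          rw [norm_mul, Complex.norm_real, Real.norm_eq_abs, pow_succ]; ring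
      _ ≤ C := by rw [hkey]; exact hC x

end families

/-! ### Decay, continuity and square integrability of $T_If$. -/

/-- `T_I f` decays rapidly. -/
theorem exists_norm_fioTypeI_le {d : ℕ} {Φ : Rd d × Rd d → ℝ} {σ : Rd d × Rd d → ℂ}
    (hΦ : IsTamePhase Φ) (hσ : IsHormanderSymbol σ) (f : 𝓢(Rd d, ℂ)) (N : ℕ) :
    ∃ C : ℝ, 0 ≤ C ∧ ∀ x, (1 + ‖x‖) ^ N * ‖fioTypeI Φ σ f x‖ ≤ C := by
  have hslice : ∀ x : Rd d, ContDiff ℝ ∞ fun ξ : Rd d => Φ (x, ξ) := fun x =>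
    hΦ.smooth.comp (by fun_prop)
  have hb : ∀ n : ℕ, 2 ≤ n → ∃ C : ℝ, ∀ (x : Rd d) ξ,
      ‖iteratedFDeriv ℝ n (fun ξ : Rd d => Φ (x, ξ)) ξ‖ ≤ C := fun n hn => by
    obtain ⟨C, hC⟩ := hΦ.bounded_deriv n hn
    exact ⟨C, fun x ξ => (norm_iteratedFDeriv_slice_le hΦ.smooth n x ξ).trans (hC _)⟩
  have ha : UniformlySchwartz fun (x : Rd d) ξ => σ (x, ξ) * (𝓕 f) ξ := by
    refine UniformlyTemperate.mul_uniformlySchwartz (m := fun (x : Rd d) ξ => σ (x, ξ))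
      (a := fun (_ : Rd d) ξ => (𝓕 f) ξ) ⟨fun x => hσ.smooth.comp (by fun_prop), fun n => ?_⟩
      ⟨fun _ => (𝓕 f).smooth ⊤, fun k n => ?_⟩
    · obtain ⟨C, hC⟩ := hσ.bounded_deriv n
      refine ⟨0, |C|, abs_nonneg _, fun x ξ => ?_⟩
      rw [pow_zero, mul_one]
      exact (norm_iteratedFDeriv_slice_le hσ.smooth n x ξ).trans ((hC _).trans (le_abs_self C))
    · obtain ⟨C, -, hC⟩ := (𝓕 f).decay k n
      exact ⟨C, fun _ => hC⟩
  -- The direction of steepest ascent, along which the derivative at $\xi=0$ is the full norm of the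
  -- gradient. Where the gradient vanishes, $0^{-1}=0$ gives $\nu=0$, which does no harm.
  set ν : Rd d → Rd d := fun x => (‖gradSnd Φ (x, 0)‖)⁻¹ • gradSnd Φ (x, 0) with hνdef
  have hν : ∀ x, ‖ν x‖ ≤ 1 := fun x => by
    rw [hνdef, norm_smul, norm_inv, norm_norm]
    exact inv_mul_le_one
  have hfd : ∀ x, fderiv ℝ (fun ξ => Φ (x, ξ)) 0 (ν x) = ‖gradSnd Φ (x, 0)‖ := fun x => by
    have h1 : HasFDerivAt (fun ξ => Φ (x, ξ))
        ((fderiv ℝ Φ (x, 0)).comp (ContinuousLinearMap.inr ℝ (Rd d) (Rd d))) 0 :=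
      ((hΦ.smooth.differentiable (by simp)).differentiableAt (x := (x, 0))).hasFDerivAt.comp 0
        (hasFDerivAt_prodMk_right x 0)
    rw [h1.fderiv]
    have h2 : ((fderiv ℝ Φ (x, 0)).comp (ContinuousLinearMap.inr ℝ (Rd d) (Rd d))) (ν x) =
        inner ℝ (gradSnd Φ (x, 0)) (ν x) := by rw [inner_gradSnd]; simp
    rw [h2, hνdef, inner_smul_right, real_inner_self_eq_norm_mul_norm, ← mul_assoc]
    exact inv_mul_mul_self _
  obtain ⟨C, hC0, hC⟩ := hΦ.norm_le_gradSnd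
  obtain ⟨D0, hD0⟩ := exists_pow_mul_norm_integral_osc_le volume hslice hb hν 0 ha
  obtain ⟨D1, hD1⟩ := exists_pow_mul_norm_integral_osc_le volume hslice hb hν N ha
  have hT : ∀ x, fioTypeI Φ σ f x = ∫ ξ, osc (Φ (x, ξ)) * (σ (x, ξ) * (𝓕 f) ξ) := fun x => by
    simp only [fioTypeI, osc, mul_assoc]
  simp_rw [← hT, hfd, abs_norm] at hD0 hD1
  refine ⟨(1 + C) ^ N * (2 ^ N * (|D0| + |D1|)), by positivity, fun x => ?_⟩
  set l := ‖gradSnd Φ (x, 0)‖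
  have hl : 0 ≤ l := norm_nonneg _
  have h1 : 1 + ‖x‖ ≤ (1 + C) * (1 + l) := by nlinarith [hC x]
  have h2 : (1 + l) ^ N ≤ 2 ^ N * (1 + l ^ N) := by
    have h := add_pow_le (zero_le_one' ℝ) hl N
    rw [one_pow] at h
    refine h.trans ?_
    gcongr
    · norm_num
    · omega
  have h3 := (hD0 x).trans (le_abs_self _)
  have h4 := (hD1 x).trans (le_abs_self _)
  rw [pow_zero, one_mul] at h3
  calc (1 + ‖x‖) ^ N * ‖fioTypeI Φ σ f x‖
      ≤ ((1 + C) * (1 + l)) ^ N * ‖fioTypeI Φ σ f x‖ := by gcongr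
    _ = (1 + C) ^ N * ((1 + l) ^ N * ‖fioTypeI Φ σ f x‖) := by rw [mul_pow]; ring
    _ ≤ (1 + C) ^ N * (2 ^ N * (1 + l ^ N) * ‖fioTypeI Φ σ f x‖) := by gcongr
    _ = (1 + C) ^ N * (2 ^ N * (‖fioTypeI Φ σ f x‖ + l ^ N * ‖fioTypeI Φ σ f x‖)) := by ring
    _ ≤ _ := by gcongr

theorem continuous_fioTypeI {d : ℕ} {Φ : Rd d × Rd d → ℝ} {σ : Rd d × Rd d → ℂ}
    (hΦ : IsTamePhase Φ) (hσ : IsHormanderSymbol σ) (f : 𝓢(Rd d, ℂ)) :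
    Continuous (fioTypeI Φ σ f) := by
  obtain ⟨C, hC⟩ := hσ.bounded_deriv 0
  have hΦc := hΦ.smooth.continuous
  have hσc := hσ.smooth.continuous
  refine continuous_of_dominated (bound := fun ξ => C * ‖(𝓕 f) ξ‖) (fun x => ?_)
    (fun x => .of_forall fun ξ => ?_) ((𝓕 f).integrable.norm.const_mul C) (.of_forall fun ξ => ?_)
  · have : Continuous fun ξ => Complex.exp (2 * Real.pi * Complex.I * Φ (x, ξ)) * σ (x, ξ) *
        (𝓕 f) ξ := by
      have := (𝓕 f).continuous
      fun_prop
    exact this.aestronglyMeasurable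
  · have h1 := norm_osc (Φ (x, ξ))
    rw [osc] at h1
    have h2 := hC (x, ξ)
    rw [norm_iteratedFDeriv_zero] at h2
    rw [norm_mul, norm_mul, h1, one_mul]
    gcongr
  · fun_prop

theorem memLp_fioTypeI {d : ℕ} {Φ : Rd d × Rd d → ℝ} {σ : Rd d × Rd d → ℂ}
    (hΦ : IsTamePhase Φ) (hσ : IsHormanderSymbol σ) (f : 𝓢(Rd d, ℂ)) :
    Integrable (fioTypeI Φ σ f) ∧ MemLp (fioTypeI Φ σ f) 2 := by
  set n := (volume : Measure (Rd d)).integrablePower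
  obtain ⟨C, hC0, hC⟩ := exists_norm_fioTypeI_le hΦ hσ f n
  have hI := ((volume : Measure (Rd d)).integrable_pow_neg_integrablePower).const_mul C
  have hle : ∀ x, ‖fioTypeI Φ σ f x‖ ≤ C * (1 + ‖x‖) ^ (-(n : ℝ)) := fun x => by
    have hp : 0 < 1 + ‖x‖ := by positivity
    rw [Real.rpow_neg hp.le, Real.rpow_natCast, ← div_eq_mul_inv, le_div_iff₀ (by positivity),
      mul_comm]
    exact hC x
  have hmeas := (continuous_fioTypeI hΦ hσ f).aestronglyMeasurable (μ := volume)
  have hint : Integrable (fioTypeI Φ σ f) := hI.mono' hmeas (.of_forall hle)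
  refine ⟨hint, ?_⟩
  obtain ⟨B, -, hB⟩ := exists_norm_fioTypeI_le hΦ hσ f 0
  simp_rw [pow_zero, one_mul] at hB
  rw [memLp_two_iff_integrable_sq_norm hmeas]
  refine (hint.norm.const_mul B).mono' (hmeas.norm.pow 2) (.of_forall fun x => ?_)
  rw [Real.norm_eq_abs, abs_of_nonneg (by positivity), sq]
  gcongr
  exact hB x

/-! ### The partial Fourier transform on Schwartz spaces. -/

section partialFourier

universe u

variable {E V W : Type u} [NormedAddCommGroup E] [NormedSpace ℝ E] [NormedAddCommGroup V]
  [NormedSpace ℝ V] [NormedAddCommGroup W] [NormedSpace ℝ W]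

theorem osc_eq_fourierChar (s : ℝ) : osc s = (Real.fourierChar s : ℂ) := by
  rw [osc, Real.fourierChar_apply]
  congr 1
  push_cast
  ring

theorem osc_add (s t : ℝ) : osc (s + t) = osc s * osc t := by
  rw [osc, osc, osc, ← Complex.exp_add]
  congr 1
  push_cast
  ring

theorem exp_neg_eq_osc (s : ℝ) :
    Complex.exp (-(2 * Real.pi * Complex.I * (s : ℂ))) = osc (-s) := by
  rw [osc]; push_cast; ring_nf

theorem star_osc (s : ℝ) : starRingEnd ℂ (osc s) = osc (-s) := by
  rw [osc, osc, ← Complex.exp_conj]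
  congr 1
  simp [Complex.conj_ofNat]

/-- The partial Fourier transform with respect to a pairing `L`, in the second variable. -/
noncomputable def partialFourier {F : Type*} [NormedAddCommGroup F] [NormedSpace ℂ F]
    [MeasurableSpace V] (μ : Measure V) (L : V →L[ℝ] W →L[ℝ] ℝ) (G : E × V → F) (z : E × W) : F :=
  ∫ v, osc (-(L v z.2)) • G (z.1, v) ∂μ

variable {F : Type u} [NormedAddCommGroup F] [NormedSpace ℂ F]

/-- The seminorm controlling slices of Schwartz functions. -/
noncomputable def sliceSeminorm (E V F : Type u) [NormedAddCommGroup E] [NormedSpace ℝ E]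
    [NormedAddCommGroup V] [NormedSpace ℝ V] [NormedAddCommGroup F] [NormedSpace ℂ F]
    (m k : ℕ) : Seminorm ℝ 𝓢(E × V, F) :=
  (2 ^ (m + k) : NNReal) • (Finset.Iic (m + k, k)).sup
    (schwartzSeminormFamily ℝ (E × V) F)

theorem continuous_sliceSeminorm (m k : ℕ) : Continuous (sliceSeminorm E V F m k) := by
  have h : Continuous ((Finset.Iic (m + k, k)).sup
      (schwartzSeminormFamily ℝ (E × V) F) : Seminorm ℝ 𝓢(E × V, F)) :=
    Seminorm.continuous_finsetSup fun i _ =>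
      (schwartz_withSeminorms ℝ (E × V) F).continuous_seminorm i
  exact h.const_smul (2 ^ (m + k) : NNReal)

/-- Both $\|x\|$ and $1+\|v\|$ are at most $1+\|(x,v)\|$, so a weight of order $m+i\le m+k$ pays for
both factors. With $m$ the integrable power, the bound can be integrated in $v$ uniformly in $x$. -/
theorem le_sliceSeminorm (G : 𝓢(E × V, F)) (m k : ℕ) {i j : ℕ} (hi : i ≤ k) (hj : j ≤ k) (x : E)
    (v : V) : ‖x‖ ^ i * ‖iteratedFDeriv ℝ j (fun v => G (x, v)) v‖ ≤
      sliceSeminorm E V F m k G * (1 + ‖v‖) ^ (-(m : ℝ)) := by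
  have h := SchwartzMap.one_add_le_sup_seminorm_apply (𝕜 := ℝ) (m := (m + k, k)) (k := m + i)
    (n := j) (by simpa using hi) hj G (x, v)
  have hv : 0 < 1 + ‖v‖ := by positivity
  rw [Real.rpow_neg hv.le, Real.rpow_natCast, ← div_eq_mul_inv, le_div_iff₀ (by positivity)]
  refine le_trans ?_ h
  have h1 := norm_iteratedFDeriv_slice_le (G.smooth ⊤) j x v
  have h2 : ‖x‖ ≤ 1 + ‖((x, v) : E × V)‖ := by
    have := norm_fst_le (x, v); simp only at this; linarith
  have h3 : 1 + ‖v‖ ≤ 1 + ‖((x, v) : E × V)‖ := by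
    have := norm_snd_le (x, v); simp only at this; linarith
  calc ‖x‖ ^ i * ‖iteratedFDeriv ℝ j (fun v => G (x, v)) v‖ * (1 + ‖v‖) ^ m
      ≤ (1 + ‖((x, v) : E × V)‖) ^ i * ‖iteratedFDeriv ℝ j G (x, v)‖ *
        (1 + ‖((x, v) : E × V)‖) ^ m := by gcongr
    _ = _ := by rw [pow_add]; ring

variable [FiniteDimensional ℝ V] [MeasurableSpace V] [BorelSpace V]
  (μ : Measure V) [μ.IsAddHaarMeasure] (L : V →L[ℝ] W →L[ℝ] ℝ)

theorem integrable_iteratedFDeriv_slice (G : 𝓢(E × V, F)) (j : ℕ) (x : E) :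
    Integrable (fun v => ‖iteratedFDeriv ℝ j (fun v => G (x, v)) v‖) μ := by
  refine (μ.integrable_pow_neg_integrablePower.const_mul
    (sliceSeminorm E V F μ.integrablePower j G)).mono' ?_ (.of_forall fun v => ?_)
  · have : ContDiff ℝ ∞ fun v => G (x, v) := (G.smooth ⊤).comp (by fun_prop)
    exact (this.continuous_iteratedFDeriv (by exact_mod_cast le_top)).norm.aestronglyMeasurable
  · have := le_sliceSeminorm G μ.integrablePower j (Nat.zero_le j) le_rfl x v
    rw [pow_zero, one_mul] at this
    rwa [norm_norm]

theorem integrable_slice (G : 𝓢(E × V, F)) (x : E) : Integrable (fun v => G (x, v)) μ := by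
  have h := integrable_iteratedFDeriv_slice μ G 0 x
  simp_rw [norm_iteratedFDeriv_zero] at h
  have hc : Continuous fun v => G (x, v) := G.continuous.comp (by fun_prop)
  exact (integrable_norm_iff hc.aestronglyMeasurable).1 h

omit [NormedSpace ℝ V] [FiniteDimensional ℝ V] [μ.IsAddHaarMeasure] in
theorem integrable_osc_smul {f : V → F} {ψ : V → ℝ} (hψ : Continuous ψ) (hf : Integrable f μ) :
    Integrable (fun v => osc (ψ v) • f v) μ :=
  hf.bdd_smul 1 (continuous_osc.comp hψ).aestronglyMeasurable (.of_forall fun _ => (norm_osc _).le)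

theorem pow_mul_integral_iteratedFDeriv_slice_le (G : 𝓢(E × V, F)) {k i j : ℕ} (hi : i ≤ k)
    (hj : j ≤ k) (x : E) :
    ‖x‖ ^ i * ∫ v, ‖iteratedFDeriv ℝ j (fun v => G (x, v)) v‖ ∂μ ≤
      sliceSeminorm E V F μ.integrablePower k G *
        ∫ v, (1 + ‖v‖) ^ (-(μ.integrablePower : ℝ)) ∂μ := by
  rw [← integral_const_mul, ← integral_const_mul]
  exact integral_mono ((integrable_iteratedFDeriv_slice μ G j x).const_mul _)
    (μ.integrable_pow_neg_integrablePower.const_mul _)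
    fun v => le_sliceSeminorm G μ.integrablePower k hi hj x v

/-- Decay of partial Fourier transforms of Schwartz functions. -/
theorem pow_mul_norm_partialFourier_le (hL : ∀ w, ∃ v, ‖v‖ ≤ ‖w‖ ∧ ‖w‖ ^ 2 ≤ |L v w|)
    (G : 𝓢(E × V, F)) (k : ℕ) (z : E × W) :
    ‖z‖ ^ k * ‖partialFourier μ L G z‖ ≤
      (1 + 2 ^ k * (k + 1)) * (∫ v, (1 + ‖v‖) ^ (-(μ.integrablePower : ℝ)) ∂μ) *
        sliceSeminorm E V F μ.integrablePower k G := by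
  obtain ⟨x, w⟩ := z
  set S := sliceSeminorm E V F μ.integrablePower k G *
        ∫ v, (1 + ‖v‖) ^ (-(μ.integrablePower : ℝ)) ∂μ with hS
  have hbase : ‖partialFourier μ L G (x, w)‖ ≤
      ∫ v, ‖iteratedFDeriv ℝ 0 (fun v => G (x, v)) v‖ ∂μ := by
    refine (norm_integral_le_integral_norm _).trans (le_of_eq ?_)
    simp_rw [norm_smul, norm_osc, one_mul, norm_iteratedFDeriv_zero]
  have hx : ‖x‖ ^ k * ‖partialFourier μ L G (x, w)‖ ≤ S :=
    (mul_le_mul_of_nonneg_left hbase (by positivity)).trans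
      (pow_mul_integral_iteratedFDeriv_slice_le μ G le_rfl (Nat.zero_le k) x)
  have hS0 : 0 ≤ S := le_trans (by positivity) hx
  have hw : ‖w‖ ^ k * ‖partialFourier μ L G (x, w)‖ ≤ 2 ^ k * (k + 1) * S := by
    -- Differentiating $k$ times along $v$ gains $|L(v,w)|^k\ge\|w\|^{2k}$ and costs
    -- $\|v\|^k\le\|w\|^k$. Cancelling $\|w\|^k$ leaves the decay, and $w=0$ is treated apart.
    obtain ⟨v, hv, hvw⟩ := hL w
    have hsm : ContDiff ℝ ((k : ℕ∞) : WithTop ℕ∞) fun v => G (x, v) :=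
      (G.smooth k).comp (by fun_prop)
    have h := VectorFourier.pow_mul_norm_iteratedFDeriv_fourierIntegral_le L (μ := μ)
      (f := fun v => G (x, v)) (K := 0) (N := k) hsm (fun i n hi _ => by
        have : i = 0 := by simpa using hi
        subst this
        simpa using integrable_iteratedFDeriv_slice μ G n x) (k := 0) (n := k) le_rfl le_rfl v w
    have hFI : VectorFourier.fourierIntegral Real.fourierChar μ L.toLinearMap₁₂
        (fun v => G (x, v)) w = partialFourier μ L G (x, w) := by
      simp only [VectorFourier.fourierIntegral, partialFourier, osc_eq_fourierChar,
        Circle.smul_def]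
      rfl
    rw [norm_iteratedFDeriv_zero, hFI] at h
    have hsum : ∑ p ∈ Finset.range (0 + 1) ×ˢ Finset.range (k + 1),
        ∫ v, ‖v‖ ^ p.1 * ‖iteratedFDeriv ℝ p.2 (fun v => G (x, v)) v‖ ∂μ ≤ (k + 1) * S := by
      refine (Finset.sum_le_card_nsmul _ _ S fun p hp => ?_).trans ?_
      · rw [Finset.mem_product, Finset.mem_range, Finset.mem_range] at hp
        have hp1 : p.1 = 0 := by omega
        have := pow_mul_integral_iteratedFDeriv_slice_le μ G (Nat.zero_le k)
          (show p.2 ≤ k by omega) x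
        simpa only [hp1, pow_zero, one_mul] using this
      · simp
    rcases eq_or_lt_of_le (norm_nonneg w) with hw0 | hw0
    · rcases Nat.eq_zero_or_pos k with hk | hk
      · subst hk
        simp only [pow_zero, one_mul, CharP.cast_eq_zero, zero_add] at hx ⊢
        exact hx
      · rw [← hw0, zero_pow hk.ne', zero_mul]; positivity
    · have h2 : ‖w‖ ^ k * (‖w‖ ^ k * ‖partialFourier μ L G (x, w)‖) ≤
          ‖w‖ ^ k * (2 ^ k * (k + 1) * S) := by
        calc _ = (‖w‖ ^ 2) ^ k * ‖partialFourier μ L G (x, w)‖ := by ring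
          _ ≤ |L v w| ^ k * ‖partialFourier μ L G (x, w)‖ := by gcongr
          _ ≤ _ := h
          _ = ‖v‖ ^ k * (2 ^ k * ∑ p ∈ Finset.range (0 + 1) ×ˢ Finset.range (k + 1),
              ∫ v, ‖v‖ ^ p.1 * ‖iteratedFDeriv ℝ p.2 (fun v => G (x, v)) v‖ ∂μ) := by
            push_cast; ring
          _ ≤ ‖w‖ ^ k * (2 ^ k * ((k + 1) * S)) := by gcongr
          _ = _ := by ring
      exact le_of_mul_le_mul_left h2 (by positivity)
  have hmax : ‖((x, w) : E × W)‖ ^ k ≤ ‖x‖ ^ k + ‖w‖ ^ k := by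
    rw [Prod.norm_mk]
    rcases max_cases ‖x‖ ‖w‖ with h | h
    · rw [h.1]; have : 0 ≤ ‖w‖ ^ k := by positivity
      linarith
    · rw [h.1]; have : 0 ≤ ‖x‖ ^ k := by positivity
      linarith
  calc _ ≤ (‖x‖ ^ k + ‖w‖ ^ k) * ‖partialFourier μ L G (x, w)‖ := by gcongr
    _ ≤ S + 2 ^ k * (k + 1) * S := by rw [add_mul]; exact add_le_add hx hw
    _ = _ := by rw [hS]; ring

/-- The operator on Schwartz functions which corresponds to differentiation after the partial
Fourier transform. -/
noncomputable def partialFourierDeriv : 𝓢(E × V, F) →L[ℝ] 𝓢(E × V, E × W →L[ℝ] F) :=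
  (SchwartzMap.postcompCLM (ContinuousLinearMap.precomp F
      ((ContinuousLinearMap.inl ℝ E V).comp (ContinuousLinearMap.fst ℝ E W)))).comp
    (SchwartzMap.fderivCLM ℝ (E × V) F) +
  (SchwartzMap.smulRightCLM ℝ F ((((ContinuousLinearMap.compL ℝ (E × W) W ℝ).flip
      (ContinuousLinearMap.snd ℝ E W)).comp L).comp (ContinuousLinearMap.snd ℝ E V))).comp
    (SchwartzMap.postcompCLM ((-(2 * Real.pi * Complex.I)) • ContinuousLinearMap.id ℝ F))

omit [FiniteDimensional ℝ V] [MeasurableSpace V] [BorelSpace V] in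
theorem partialFourierDeriv_apply (G : 𝓢(E × V, F)) (y : E × V) :
    partialFourierDeriv L G y =
      (fderiv ℝ G y).comp ((ContinuousLinearMap.inl ℝ E V).comp (ContinuousLinearMap.fst ℝ E W)) +
      ((L y.2).comp (ContinuousLinearMap.snd ℝ E W)).smulRight
        ((-(2 * Real.pi * Complex.I)) • G y) := rfl

/-- Derivatives in $E$ fall on $G$ and those in $W$ bring down $-2\pi iL(v,\cdot)$. Hence the
derivative is once more the partial Fourier transform of a Schwartz function, which makes induction
on the order possible. -/
theorem hasFDerivAt_partialFourier (G : 𝓢(E × V, F)) (z : E × W) :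
    HasFDerivAt (partialFourier μ L G) (partialFourier μ L (partialFourierDeriv L G) z) z := by
  have hosc : ∀ z : E × W, Continuous fun v => osc (-(L v z.2)) := fun z =>
    continuous_osc.comp (by fun_prop)
  have hslice : ∀ x : E, Continuous fun v => G (x, v) := fun x => G.continuous.comp (by fun_prop)
  have hslice' : ∀ x : E, Continuous fun v => partialFourierDeriv L G (x, v) := fun x =>
    (partialFourierDeriv L G).continuous.comp (by fun_prop)
  refine hasFDerivAt_integral_of_dominated_of_fderiv_le (𝕜 := ℝ)
    (F := fun z v => osc (-(L v z.2)) • G (z.1, v))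
    (F' := fun z v => osc (-(L v z.2)) • partialFourierDeriv L G (z.1, v))
    (bound := fun v => sliceSeminorm E V (E × W →L[ℝ] F) μ.integrablePower 0
      (partialFourierDeriv L G) * (1 + ‖v‖) ^ (-(μ.integrablePower : ℝ)))
    Filter.univ_mem (.of_forall fun z => ?_) ?_ ?_ (.of_forall fun v z _ => ?_)
    (μ.integrable_pow_neg_integrablePower.const_mul _) (.of_forall fun v z _ => ?_)
  · exact ((hosc z).smul (hslice z.1)).aestronglyMeasurable
  · exact integrable_osc_smul μ (by fun_prop) (integrable_slice μ G z.1)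
  · exact ((hosc z).smul (hslice' z.1)).aestronglyMeasurable
  · rw [norm_smul, norm_osc, one_mul]
    have := le_sliceSeminorm (partialFourierDeriv L G) μ.integrablePower 0 le_rfl le_rfl z.1 v
    rwa [pow_zero, one_mul, norm_iteratedFDeriv_zero] at this
  · have h1 : HasFDerivAt (fun z : E × W => osc (-(L v z.2)))
        ((2 * Real.pi * Complex.I * osc (-(L v z.2))) •
          (Complex.ofRealCLM.comp (-((L v).comp (ContinuousLinearMap.snd ℝ E W))))) z :=
      hasFDerivAt_osc_comp ((L v).hasFDerivAt.comp z hasFDerivAt_snd).neg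
    have h2 : HasFDerivAt (fun z : E × W => G (z.1, v))
        ((fderiv ℝ G (z.1, v)).comp
          ((ContinuousLinearMap.inl ℝ E V).comp (ContinuousLinearMap.fst ℝ E W))) z :=
      (((G.smooth ⊤).differentiable (by simp)).differentiableAt (x := (z.1, v))).hasFDerivAt.comp z
        (HasFDerivAt.comp (g := fun x : E => (x, v)) z (hasFDerivAt_prodMk_left z.1 v)
          hasFDerivAt_fst)
    refine (h1.smul h2).congr_fderiv ?_
    rw [partialFourierDeriv_apply, smul_add]
    congr 1
    refine ContinuousLinearMap.ext fun y => ?_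
    change ((2 * Real.pi * Complex.I * osc (-(L v z.2))) * ((-(L v y.2) : ℝ) : ℂ)) • G (z.1, v) =
      osc (-(L v z.2)) • (L v y.2 • (-(2 * Real.pi * Complex.I)) • G (z.1, v))
    rw [← Complex.coe_smul (L v y.2), smul_smul, smul_smul]
    congr 1
    push_cast
    ring

/-- Each differentiation replaces the target $F$ by the continuous linear maps from $E\times W$ to
$F$, so the induction has to quantify over $F$. The common universe keeps the new target in range.
-/
theorem partialFourier_smooth_and_decay (hL : ∀ w, ∃ v, ‖v‖ ≤ ‖w‖ ∧ ‖w‖ ^ 2 ≤ |L v w|) (n : ℕ) :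
    ∀ (F : Type u) [NormedAddCommGroup F] [NormedSpace ℂ F],
      (∀ G : 𝓢(E × V, F), ContDiff ℝ n (partialFourier μ L G)) ∧
      ∀ k : ℕ, ∃ q : Seminorm ℝ 𝓢(E × V, F), Continuous q ∧ ∀ (G : 𝓢(E × V, F)) z,
        ‖z‖ ^ k * ‖iteratedFDeriv ℝ n (partialFourier μ L (G : E × V → F)) z‖ ≤ q G := by
  induction n with
  | zero =>
    intro F _ _
    refine ⟨fun G => contDiff_zero.2 (continuous_iff_continuousAt.2 fun z =>
      (hasFDerivAt_partialFourier μ L G z).continuousAt), fun k => ?_⟩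
    have h0 : 0 ≤ (1 + 2 ^ k * (k + 1)) *
        (∫ v, (1 + ‖v‖) ^ (-(μ.integrablePower : ℝ)) ∂μ) :=
      mul_nonneg (by positivity) (integral_nonneg fun v => by positivity)
    let c : NNReal := ⟨_, h0⟩
    refine ⟨c • sliceSeminorm E V F μ.integrablePower k,
      (continuous_sliceSeminorm _ k).const_smul c, fun G z => ?_⟩
    rw [norm_iteratedFDeriv_zero]
    exact pow_mul_norm_partialFourier_le μ L hL G k z
  | succ n ih =>
    intro F _ _
    obtain ⟨h1, h2⟩ := ih (E × W →L[ℝ] F)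
    have hfd : ∀ G : 𝓢(E × V, F), fderiv ℝ (partialFourier μ L G) =
        partialFourier μ L (partialFourierDeriv L G) := fun G =>
      funext fun z => (hasFDerivAt_partialFourier μ L G z).fderiv
    refine ⟨fun G => ?_, fun k => ?_⟩
    · exact contDiff_succ_iff_hasFDerivAt.2
        ⟨_, h1 (partialFourierDeriv L G), hasFDerivAt_partialFourier μ L G⟩
    · obtain ⟨q, hq, hle⟩ := h2 k
      refine ⟨q.comp (partialFourierDeriv L).toLinearMap,
        hq.comp (partialFourierDeriv L).continuous, fun G z => ?_⟩
      rw [← norm_iteratedFDeriv_fderiv, hfd]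
      exact hle (partialFourierDeriv L G) z

/-- The partial Fourier transform on Schwartz functions, as a real-linear map. -/
noncomputable def partialFourierRealCLM (hL : ∀ w, ∃ v, ‖v‖ ≤ ‖w‖ ∧ ‖w‖ ^ 2 ≤ |L v w|) :
    𝓢(E × V, F) →L[ℝ] 𝓢(E × W, F) :=
  SchwartzMap.mkCLM (fun G => partialFourier μ L G)
    (fun G H z => by
      have hI : ∀ G : 𝓢(E × V, F), Integrable (fun v => osc (-(L v z.2)) • G (z.1, v)) μ := fun G =>
        integrable_osc_smul μ (by fun_prop) (integrable_slice μ G z.1)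
      simp only [partialFourier, ← integral_add (hI G) (hI H)]
      simp)
    (fun a G z => by
      simp only [partialFourier, RingHom.id_apply, ← integral_smul]
      congr 1
      ext v
      exact smul_comm _ _ _)
    (fun G => contDiff_infty.2 fun n => (partialFourier_smooth_and_decay μ L hL n F).1 G)
    (fun n => by
      obtain ⟨q, hq, hle⟩ := (partialFourier_smooth_and_decay (E := E) μ L hL n.2 F).2 n.1
      obtain ⟨s, C, -, hC⟩ := Seminorm.bound_of_continuous (schwartz_withSeminorms ℝ (E × V) F) q hq
      exact ⟨s, C, C.2, fun G z => (hle G z).trans (hC G)⟩)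

/-- The partial Fourier transform on Schwartz functions. -/
noncomputable def partialFourierCLM (hL : ∀ w, ∃ v, ‖v‖ ≤ ‖w‖ ∧ ‖w‖ ^ 2 ≤ |L v w|) :
    𝓢(E × V, F) →L[ℂ] 𝓢(E × W, F) where
  toFun := partialFourierRealCLM μ L hL
  map_add' := map_add _
  map_smul' c G := by
    ext z
    change ∫ v, osc (-(L v z.2)) • (c • G (z.1, v)) ∂μ = c • ∫ v, osc (-(L v z.2)) • G (z.1, v) ∂μ
    rw [← integral_smul]
    congr 1
    ext v
    exact smul_comm _ _ _
  cont := (partialFourierRealCLM μ L hL).continuous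

theorem partialFourierCLM_apply (hL : ∀ w, ∃ v, ‖v‖ ≤ ‖w‖ ∧ ‖w‖ ^ 2 ≤ |L v w|)
    (G : 𝓢(E × V, F)) (z : E × W) :
    partialFourierCLM μ L hL G z = ∫ v, osc (-(L v z.2)) • G (z.1, v) ∂μ := rfl

end partialFourier

/-! ### Tensor products, conjugates and rearrangements of variables. -/

instance isAddHaarMeasure_volume_prod_Rd (d : ℕ) :
    (volume : Measure (Rd d × Rd d)).IsAddHaarMeasure :=
  Measure.prod.instIsAddHaarMeasure volume volume

instance isAddHaarMeasure_volume_prod_prod_Rd (d : ℕ) :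
    (volume : Measure ((Rd d × Rd d) × (Rd d × Rd d))).IsAddHaarMeasure :=
  Measure.prod.instIsAddHaarMeasure volume volume

/-- The tensor product of two Schwartz functions. -/
noncomputable def SchwartzMap.tensor {E V : Type*} [NormedAddCommGroup E] [NormedSpace ℝ E]
    [NormedAddCommGroup V] [NormedSpace ℝ V] (f : 𝓢(E, ℂ)) (g : 𝓢(V, ℂ)) : 𝓢(E × V, ℂ) where
  toFun z := f z.1 * g z.2
  smooth' := ((f.smooth ⊤).comp contDiff_fst).mul ((g.smooth ⊤).comp contDiff_snd)
  decay' := by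
    intro k n
    have hf1 : ∀ (i : ℕ) (z : E × V),
        ‖iteratedFDeriv ℝ i (fun z : E × V => f z.1) z‖ ≤ ‖iteratedFDeriv ℝ i f z.1‖ := by
      intro i z
      have h := (ContinuousLinearMap.fst ℝ E V).iteratedFDeriv_comp_right (f.smooth i) z
        (i := i) le_rfl
      change ‖iteratedFDeriv ℝ i (f ∘ (ContinuousLinearMap.fst ℝ E V)) z‖ ≤ _
      rw [h]
      refine (ContinuousMultilinearMap.norm_compContinuousLinearMap_le _ _).trans ?_
      exact mul_le_of_le_one_right (norm_nonneg _) (Finset.prod_le_one (fun _ _ => norm_nonneg _)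
        fun _ _ => ContinuousLinearMap.norm_fst_le ℝ E V)
    have hg1 : ∀ (i : ℕ) (z : E × V),
        ‖iteratedFDeriv ℝ i (fun z : E × V => g z.2) z‖ ≤ ‖iteratedFDeriv ℝ i g z.2‖ := by
      intro i z
      have h := (ContinuousLinearMap.snd ℝ E V).iteratedFDeriv_comp_right (g.smooth i) z
        (i := i) le_rfl
      change ‖iteratedFDeriv ℝ i (g ∘ (ContinuousLinearMap.snd ℝ E V)) z‖ ≤ _
      rw [h]
      refine (ContinuousMultilinearMap.norm_compContinuousLinearMap_le _ _).trans ?_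
      exact mul_le_of_le_one_right (norm_nonneg _) (Finset.prod_le_one (fun _ _ => norm_nonneg _)
        fun _ _ => ContinuousLinearMap.norm_snd_le ℝ E V)
    choose C hC0 hC using f.decay
    choose D hD0 hD using g.decay
    refine ⟨∑ i ∈ Finset.range (n + 1), (n.choose i) *
      (C k i * D 0 (n - i) + C 0 i * D k (n - i)), fun z => ?_⟩
    have hmul := norm_iteratedFDeriv_mul_le (N := ∞) (n := n)
      ((f.smooth ⊤).comp (contDiff_fst (F := V))) ((g.smooth ⊤).comp (contDiff_snd (E := E))) z
      (by exact_mod_cast le_top)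
    refine (mul_le_mul_of_nonneg_left hmul (by positivity)).trans ?_
    rw [Finset.mul_sum]
    refine Finset.sum_le_sum fun i _ => ?_
    have hz : ‖z‖ ^ k ≤ ‖z.1‖ ^ k + ‖z.2‖ ^ k := by
      rw [Prod.norm_def]
      rcases max_cases ‖z.1‖ ‖z.2‖ with h | h
      · rw [h.1]; have : 0 ≤ ‖z.2‖ ^ k := by positivity
        linarith
      · rw [h.1]; have : 0 ≤ ‖z.1‖ ^ k := by positivity
        linarith
    have h1 := hf1 i z
    have h2 := hg1 (n - i) z
    have a1 := hC k i z.1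
    have a2 := hC 0 i z.1
    have b1 := hD k (n - i) z.2
    have b2 := hD 0 (n - i) z.2
    rw [pow_zero, one_mul] at a2 b2
    calc ‖z‖ ^ k * ((n.choose i) * ‖iteratedFDeriv ℝ i (fun z : E × V => f z.1) z‖ *
          ‖iteratedFDeriv ℝ (n - i) (fun z : E × V => g z.2) z‖)
        ≤ (‖z.1‖ ^ k + ‖z.2‖ ^ k) * ((n.choose i) * ‖iteratedFDeriv ℝ i f z.1‖ *
          ‖iteratedFDeriv ℝ (n - i) g z.2‖) := by gcongr
      _ = (n.choose i) * ((‖z.1‖ ^ k * ‖iteratedFDeriv ℝ i f z.1‖) *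
            ‖iteratedFDeriv ℝ (n - i) g z.2‖ + ‖iteratedFDeriv ℝ i f z.1‖ *
            (‖z.2‖ ^ k * ‖iteratedFDeriv ℝ (n - i) g z.2‖)) := by ring
      _ ≤ _ := by
        have := (hC0 k i).le
        have := (hC0 0 i).le
        gcongr

theorem SchwartzMap.tensor_apply {E V : Type*} [NormedAddCommGroup E] [NormedSpace ℝ E]
    [NormedAddCommGroup V] [NormedSpace ℝ V] (f : 𝓢(E, ℂ)) (g : 𝓢(V, ℂ)) (z : E × V) :
    f.tensor g z = f z.1 * g z.2 := rfl

/-- The complex conjugate of a Schwartz function. -/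
noncomputable def SchwartzMap.conj {E : Type*} [NormedAddCommGroup E] [NormedSpace ℝ E]
    (f : 𝓢(E, ℂ)) : 𝓢(E, ℂ) :=
  SchwartzMap.postcompCLM (𝕜 := ℝ) (Complex.conjCLE : ℂ →L[ℝ] ℂ) f

theorem SchwartzMap.conj_apply {E : Type*} [NormedAddCommGroup E] [NormedSpace ℝ E]
    (f : 𝓢(E, ℂ)) (x : E) : f.conj x = starRingEnd ℂ (f x) := rfl

section rearrangement

variable {α β γ δ : Type*} [MeasureSpace α] [MeasureSpace β] [MeasureSpace γ] [MeasureSpace δ]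
  [SFinite (volume : Measure α)] [SFinite (volume : Measure β)] [SFinite (volume : Measure γ)]
  [SFinite (volume : Measure δ)]

/-- The measurable rearrangement `((a, b), c) ↦ ((a, c), b)`. -/
def prodRightComm : (α × β) × γ ≃ᵐ (α × γ) × β :=
  (MeasurableEquiv.prodAssoc.trans
    ((MeasurableEquiv.refl α).prodCongr MeasurableEquiv.prodComm)).trans
    MeasurableEquiv.prodAssoc.symm

theorem volume_preserving_prodRightComm :
    MeasurePreserving (prodRightComm : (α × β) × γ ≃ᵐ (α × γ) × β) :=
  (volume_preserving_prodAssoc.symm _).comp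
    (((MeasurePreserving.id volume).prod Measure.measurePreserving_swap).comp
      volume_preserving_prodAssoc)

/-- The measurable rearrangement `((a, b), (c, d)) ↦ ((a, c), (b, d))`. -/
def prodProdComm : (α × β) × (γ × δ) ≃ᵐ (α × γ) × (β × δ) :=
  (MeasurableEquiv.prodAssoc.symm.trans
    (prodRightComm.prodCongr (MeasurableEquiv.refl δ))).trans MeasurableEquiv.prodAssoc

theorem volume_preserving_prodProdComm :
    MeasurePreserving (prodProdComm : (α × β) × (γ × δ) ≃ᵐ (α × γ) × (β × δ)) :=
  volume_preserving_prodAssoc.comp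
    ((volume_preserving_prodRightComm.prod (MeasurePreserving.id volume)).comp
      (volume_preserving_prodAssoc.symm _))

end rearrangement

/-! ### Wigner distributions and the two algebraic formulas. -/

section wigner

variable {d : ℕ}

/-- The change of variables `(x, t) ↦ (x + t/2, x - t/2)`. -/
noncomputable def wignerEquiv (d : ℕ) : (Rd d × Rd d) ≃L[ℝ] (Rd d × Rd d) where
  toFun z := (z.1 + (1 / 2 : ℝ) • z.2, z.1 - (1 / 2 : ℝ) • z.2)
  invFun z := ((1 / 2 : ℝ) • (z.1 + z.2), z.1 - z.2)
  map_add' z w := by ext i <;> simp <;> ring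
  map_smul' c z := by ext i <;> simp <;> ring
  left_inv z := by ext i <;> simp <;> ring
  right_inv z := by ext i <;> simp <;> ring
  continuous_toFun := by fun_prop
  continuous_invFun := by fun_prop

theorem wignerEquiv_apply (z : Rd d × Rd d) :
    wignerEquiv d z = (z.1 + (1 / 2 : ℝ) • z.2, z.1 - (1 / 2 : ℝ) • z.2) := rfl

/-- The map is a composition of swaps with $(t,x)\mapsto(t,x+t/2)$ and $(u,t)\mapsto(u,u-t)$, each
of which preserves volume. -/
theorem measurePreserving_wignerEquiv (d : ℕ) :
    MeasurePreserving (wignerEquiv d) (volume : Measure (Rd d × Rd d)) volume := by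
  have h1 : MeasurePreserving (fun p : Rd d × Rd d => (p.1, p.2 + (1 / 2 : ℝ) • p.1))
      (volume.prod volume) (volume.prod volume) :=
    (MeasurePreserving.id volume).skew_product (g := fun t x => x + (1 / 2 : ℝ) • t)
      (by simp only [Function.uncurry_def]; fun_prop)
      (.of_forall fun t => (measurePreserving_add_right volume _).map_eq)
  have h2 : MeasurePreserving (fun p : Rd d × Rd d => (p.1, p.1 - p.2))
      (volume.prod volume) (volume.prod volume) :=
    (MeasurePreserving.id volume).skew_product (g := fun u t => u - t)
      (by simp only [Function.uncurry_def]; fun_prop)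
      (.of_forall fun u => (Measure.measurePreserving_sub_left volume u).map_eq)
  have h3 := h2.comp ((Measure.measurePreserving_swap (μ := (volume : Measure (Rd d)))
    (ν := (volume : Measure (Rd d)))).comp (h1.comp Measure.measurePreserving_swap))
  convert! h3 using 1
  ext z i
  · simp [wignerEquiv_apply]
  · simp [wignerEquiv_apply]
    ring

theorem integral_comp_wignerEquiv (h : Rd d × Rd d → ℂ) :
    ∫ z, h (wignerEquiv d z) = ∫ z, h z :=
  (measurePreserving_wignerEquiv d).integral_comp
    (wignerEquiv d).toHomeomorph.measurableEmbedding h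

theorem innerSL_pairing (w : Rd d) :
    ∃ v : Rd d, ‖v‖ ≤ ‖w‖ ∧ ‖w‖ ^ 2 ≤ |innerSL ℝ v w| :=
  ⟨w, le_rfl, by rw [innerSL_apply_apply, real_inner_self_eq_norm_sq]; exact le_abs_self _⟩

/-- The function `(x, t) ↦ f(x + t/2) conj g(x - t/2)`. -/
noncomputable def wignerCorrelation (f g : 𝓢(Rd d, ℂ)) : 𝓢(Rd d × Rd d, ℂ) :=
  SchwartzMap.compCLMOfContinuousLinearEquiv ℂ (wignerEquiv d) (f.tensor g.conj)

theorem wignerCorrelation_apply (f g : 𝓢(Rd d, ℂ)) (x t : Rd d) :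
    wignerCorrelation f g (x, t) =
      f (x + (1 / 2 : ℝ) • t) * starRingEnd ℂ (g (x - (1 / 2 : ℝ) • t)) := rfl

/-- The cross-Wigner distribution of two Schwartz functions is a Schwartz function. -/
noncomputable def wignerSchwartz (f g : 𝓢(Rd d, ℂ)) : 𝓢(Rd d × Rd d, ℂ) :=
  partialFourierCLM volume (innerSL ℝ) innerSL_pairing (wignerCorrelation f g)

theorem wignerSchwartz_apply (f g : 𝓢(Rd d, ℂ)) (z : Rd d × Rd d) :
    wignerSchwartz f g z = crossWigner f g z := by
  rw [wignerSchwartz, partialFourierCLM_apply, crossWigner]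
  congr 1
  ext t
  rw [wignerCorrelation_apply, exp_neg_eq_osc, innerSL_apply_apply, smul_eq_mul, mul_comm]

theorem fourier_eq_integral_osc (f : 𝓢(Rd d, ℂ)) (ξ : Rd d) :
    (𝓕 f) ξ = ∫ x, osc (-inner ℝ x ξ) * f x := by
  rw [SchwartzMap.fourier_coe, Real.fourier_eq]
  congr 1
  ext x
  rw [osc_eq_fourierChar, Circle.smul_def, smul_eq_mul]

/-- The partial Fourier transform of the cross-Wigner distribution in the space variable. -/
theorem integral_osc_mul_crossWigner (f g : 𝓢(Rd d, ℂ)) (r η : Rd d) :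
    ∫ y, osc (-inner ℝ r y) * crossWigner f g (y, η) =
      (𝓕 f) (η + (1 / 2 : ℝ) • r) * starRingEnd ℂ ((𝓕 g) (η - (1 / 2 : ℝ) • r)) := by
  have hI : Integrable (fun p : Rd d × Rd d =>
      osc (-inner ℝ r p.1 - inner ℝ p.2 η) * wignerCorrelation f g p) :=
    integrable_osc_smul volume (ψ := fun p : Rd d × Rd d => -inner ℝ r p.1 - inner ℝ p.2 η)
      (by fun_prop) (wignerCorrelation f g).integrable
  have h1 : ∀ y, osc (-inner ℝ r y) * crossWigner f g (y, η) =
      ∫ t, osc (-inner ℝ r y - inner ℝ t η) * wignerCorrelation f g (y, t) := fun y => by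
    rw [crossWigner, ← integral_const_mul]
    congr 1
    ext t
    rw [wignerCorrelation_apply, exp_neg_eq_osc, sub_eq_add_neg (-inner ℝ r y), osc_add]
    ring
  simp_rw [h1]
  rw [← integral_prod (fun p : Rd d × Rd d =>
    osc (-inner ℝ r p.1 - inner ℝ p.2 η) * wignerCorrelation f g p) hI]
  rw [fourier_eq_integral_osc, fourier_eq_integral_osc, ← integral_conj, ← integral_prod_mul]
  rw [← Measure.volume_eq_prod]
  refine Eq.trans ?_ (integral_comp_wignerEquiv _)
  congr 1
  ext ⟨y, t⟩
  simp only [wignerEquiv_apply, map_mul, star_osc, wignerCorrelation_apply]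
  -- This is $r\cdot y+t\cdot\eta=(y+\frac t2)\cdot(\eta+\frac r2)-(y-\frac t2)\cdot(\eta-\frac
  -- r2)$.
  have h2 : osc (-inner ℝ r y - inner ℝ t η) =
      osc (-inner ℝ (y + (1 / 2 : ℝ) • t) (η + (1 / 2 : ℝ) • r)) *
        osc (- -inner ℝ (y - (1 / 2 : ℝ) • t) (η - (1 / 2 : ℝ) • r)) := by
    rw [← osc_add]
    congr 1
    simp only [inner_add_left, inner_add_right, inner_sub_left, inner_sub_right, inner_smul_left,
      inner_smul_right, real_inner_comm r y, conj_trivial]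
    ring
  rw [h2]
  ring

/-- The inner integral of the oscillatory integral is the correlation of `T_I f` and `T_I g`. -/
theorem integral_osc_phaseI (Φ : Rd d × Rd d → ℝ) (σ : Rd d × Rd d → ℂ) (f g : 𝓢(Rd d, ℂ))
    (x t : Rd d) :
    ∫ q : Rd d × Rd d, osc (phaseI Φ x q.1 t q.2) * symbolI σ x q.1 t q.2 *
        ((𝓕 f) (q.1 + (1 / 2 : ℝ) • q.2) * starRingEnd ℂ ((𝓕 g) (q.1 - (1 / 2 : ℝ) • q.2))) =
      fioTypeI Φ σ f (x + (1 / 2 : ℝ) • t) *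
        starRingEnd ℂ (fioTypeI Φ σ g (x - (1 / 2 : ℝ) • t)) := by
  rw [fioTypeI, fioTypeI, ← integral_conj, ← integral_prod_mul, ← Measure.volume_eq_prod]
  refine Eq.trans ?_ (integral_comp_wignerEquiv _)
  congr 1
  ext q
  have h : ∀ s : ℝ, Complex.exp (2 * Real.pi * Complex.I * s) = osc s := fun s => rfl
  simp only [wignerEquiv_apply, map_mul, h, star_osc, phaseI, symbolI, sub_eq_add_neg, osc_add]
  ring

end wigner

/-! ### The correlation of $T_If$ and $T_Ig$, and its pairings. -/

section correlation

variable {d : ℕ} {Φ : Rd d × Rd d → ℝ} {σ : Rd d × Rd d → ℂ}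

/-- The function `(x, t) ↦ T_I f(x + t/2) conj(T_I g(x - t/2))`. -/
noncomputable def fioCorrelation (Φ : Rd d × Rd d → ℝ) (σ : Rd d × Rd d → ℂ) (f g : 𝓢(Rd d, ℂ))
    (p : Rd d × Rd d) : ℂ :=
  fioTypeI Φ σ f (p.1 + (1 / 2 : ℝ) • p.2) *
    starRingEnd ℂ (fioTypeI Φ σ g (p.1 - (1 / 2 : ℝ) • p.2))

theorem continuous_fioCorrelation (hΦ : IsTamePhase Φ) (hσ : IsHormanderSymbol σ)
    (f g : 𝓢(Rd d, ℂ)) : Continuous (fioCorrelation Φ σ f g) :=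
  ((continuous_fioTypeI hΦ hσ f).comp (by fun_prop)).mul
    (Complex.continuous_conj.comp ((continuous_fioTypeI hΦ hσ g).comp (by fun_prop)))

/-- Since $t$ is the difference of the two arguments $u,v$, one has $1+\|t\|\le(1+\|u\|)(1+\|v\|)$,
and the decay of the two factors gives decay in $t$ uniformly in $x$. -/
theorem exists_norm_fioCorrelation_le (hΦ : IsTamePhase Φ) (hσ : IsHormanderSymbol σ)
    (f g : 𝓢(Rd d, ℂ)) (n : ℕ) :
    ∃ C, ∀ p : Rd d × Rd d, ‖fioCorrelation Φ σ f g p‖ ≤ C * (1 + ‖p.2‖) ^ (-(n : ℝ)) := by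
  obtain ⟨C, hC0, hC⟩ := exists_norm_fioTypeI_le hΦ hσ f n
  obtain ⟨D, -, hD⟩ := exists_norm_fioTypeI_le hΦ hσ g n
  refine ⟨C * D, fun ⟨x, t⟩ => ?_⟩
  have ht : 0 < 1 + ‖t‖ := by positivity
  rw [Real.rpow_neg ht.le, Real.rpow_natCast, ← div_eq_mul_inv, le_div_iff₀ (by positivity)]
  set u := x + (1 / 2 : ℝ) • t with hu
  set v := x - (1 / 2 : ℝ) • t with hv
  have huv : 1 + ‖t‖ ≤ (1 + ‖u‖) * (1 + ‖v‖) := by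
    have h1 : t = u - v := by ext i; simp [hu, hv]; ring
    have h2 : ‖t‖ ≤ ‖u‖ + ‖v‖ := by rw [h1]; exact norm_sub_le _ _
    nlinarith [norm_nonneg u, norm_nonneg v]
  have hnorm : ‖fioCorrelation Φ σ f g (x, t)‖ = ‖fioTypeI Φ σ f u‖ * ‖fioTypeI Φ σ g v‖ := by
    rw [fioCorrelation, norm_mul, RCLike.norm_conj]
  rw [hnorm]
  calc ‖fioTypeI Φ σ f u‖ * ‖fioTypeI Φ σ g v‖ * (1 + ‖t‖) ^ n
      ≤ ‖fioTypeI Φ σ f u‖ * ‖fioTypeI Φ σ g v‖ * ((1 + ‖u‖) * (1 + ‖v‖)) ^ n := by gcongr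
    _ = ((1 + ‖u‖) ^ n * ‖fioTypeI Φ σ f u‖) * ((1 + ‖v‖) ^ n * ‖fioTypeI Φ σ g v‖) := by
      rw [mul_pow]; ring
    _ ≤ C * D := mul_le_mul (hC u) (hD v) (by positivity) hC0

theorem integrable_fioCorrelation_right (hΦ : IsTamePhase Φ) (hσ : IsHormanderSymbol σ)
    (f g : 𝓢(Rd d, ℂ)) (x : Rd d) : Integrable fun t => fioCorrelation Φ σ f g (x, t) := by
  obtain ⟨C, hC⟩ := exists_norm_fioCorrelation_le hΦ hσ f g
    (volume : Measure (Rd d)).integrablePower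
  exact ((volume : Measure (Rd d)).integrable_pow_neg_integrablePower.const_mul C).mono'
    ((continuous_fioCorrelation hΦ hσ f g).comp (by fun_prop)).aestronglyMeasurable
    (.of_forall fun t => hC (x, t))

theorem crossWigner_fioTypeI (f g : 𝓢(Rd d, ℂ)) (z : Rd d × Rd d) :
    crossWigner (fioTypeI Φ σ f) (fioTypeI Φ σ g) z =
      ∫ t, osc (-inner ℝ z.2 t) * fioCorrelation Φ σ f g (z.1, t) := by
  rw [crossWigner]
  congr 1
  ext t
  rw [exp_neg_eq_osc, fioCorrelation, real_inner_comm, mul_comm]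

theorem kernelActionIntegrand_crossWigner (f g : 𝓢(Rd d, ℂ)) (z : Rd d × Rd d) (t : Rd d) :
    kernelActionIntegrand Φ σ (crossWigner f g) z t =
      osc (-inner ℝ z.2 t) * fioCorrelation Φ σ f g (z.1, t) := by
  have h : ∀ s : ℝ, Complex.exp (2 * Real.pi * Complex.I * s) = osc s := fun s => rfl
  simp_rw [kernelActionIntegrand, exp_neg_eq_osc, integral_osc_mul_crossWigner, h]
  rw [integral_osc_phaseI]
  rfl

theorem integrable_kernelActionIntegrand (hΦ : IsTamePhase Φ) (hσ : IsHormanderSymbol σ)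
    (f g : 𝓢(Rd d, ℂ)) (z : Rd d × Rd d) :
    Integrable (kernelActionIntegrand Φ σ (crossWigner f g) z) := by
  rw [funext (kernelActionIntegrand_crossWigner f g z)]
  exact integrable_osc_smul volume (ψ := fun t => -inner ℝ z.2 t) (by fun_prop)
    (integrable_fioCorrelation_right hΦ hσ f g z.1)

theorem crossWigner_fioTypeI_eq_integral (f g : 𝓢(Rd d, ℂ)) (z : Rd d × Rd d) :
    crossWigner (fioTypeI Φ σ f) (fioTypeI Φ σ g) z =
      ∫ t, kernelActionIntegrand Φ σ (crossWigner f g) z t := by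
  simp_rw [crossWigner_fioTypeI, kernelActionIntegrand_crossWigner]

/-- The partial Fourier transform of a Schwartz function on `ℝ^{2d}` in the second variable. -/
noncomputable def fourierSnd : 𝓢(Rd d × Rd d, ℂ) →L[ℂ] 𝓢(Rd d × Rd d, ℂ) :=
  partialFourierCLM volume (innerSL ℝ) innerSL_pairing

theorem fourierSnd_apply (Θ : 𝓢(Rd d × Rd d, ℂ)) (x t : Rd d) :
    fourierSnd Θ (x, t) = ∫ ξ, osc (-inner ℝ ξ t) * Θ (x, ξ) := rfl

/-- The triple integrand in $(x,\xi,t)$ is dominated by $|\Theta(x,\xi)|$ times an integrable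
function of $t$ alone, so Fubini lets the $\xi$-integration be done before the one in $t$. -/
theorem crossWigner_fioTypeI_pairing (hΦ : IsTamePhase Φ) (hσ : IsHormanderSymbol σ)
    (f g : 𝓢(Rd d, ℂ)) (Θ : 𝓢(Rd d × Rd d, ℂ)) :
    Integrable (fun z => crossWigner (fioTypeI Φ σ f) (fioTypeI Φ σ g) z * Θ z) ∧
      ∫ z, crossWigner (fioTypeI Φ σ f) (fioTypeI Φ σ g) z * Θ z =
        ∫ p, fourierSnd Θ p * fioCorrelation Φ σ f g p := by
  obtain ⟨C, hC⟩ := exists_norm_fioCorrelation_le hΦ hσ f g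
    (volume : Measure (Rd d)).integrablePower
  set H : (Rd d × Rd d) × Rd d → ℂ := fun p =>
    osc (-inner ℝ p.1.2 p.2) * fioCorrelation Φ σ f g (p.1.1, p.2) * Θ p.1 with hH
  have hHc : Continuous H :=
    ((continuous_osc.comp (by fun_prop)).mul
      ((continuous_fioCorrelation hΦ hσ f g).comp (by fun_prop))).mul
      (Θ.continuous.comp continuous_fst)
  have hHi : Integrable H := by
    have h := (Θ.integrable (μ := volume)).norm.mul_prod
      ((volume : Measure (Rd d)).integrable_pow_neg_integrablePower.const_mul C)
    refine h.mono' hHc.aestronglyMeasurable (.of_forall fun p => ?_)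
    rw [hH, norm_mul, norm_mul, norm_osc, one_mul, mul_comm]
    exact mul_le_mul_of_nonneg_left (hC (p.1.1, p.2)) (norm_nonneg _)
  have h1 : ∀ z, ∫ t, H (z, t) = crossWigner (fioTypeI Φ σ f) (fioTypeI Φ σ g) z * Θ z := fun z => by
    rw [crossWigner_fioTypeI, ← integral_mul_const]
  refine ⟨(Integrable.integral_prod_left hHi).congr (.of_forall h1), ?_⟩
  have h2 : ∫ z, crossWigner (fioTypeI Φ σ f) (fioTypeI Φ σ g) z * Θ z = ∫ p, H p := by
    simp_rw [← h1]
    exact (integral_prod H hHi).symm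
  have hmp := volume_preserving_prodRightComm (α := Rd d) (β := Rd d) (γ := Rd d)
  have hemb := (prodRightComm : (Rd d × Rd d) × Rd d ≃ᵐ _).measurableEmbedding
  rw [h2, ← hmp.integral_comp hemb]
  refine (integral_prod _ ((hmp.integrable_comp_emb hemb).2 hHi)).trans ?_
  congr 1
  ext ⟨x, t⟩
  rw [fourierSnd_apply, ← integral_mul_const]
  congr 1
  ext ξ
  change osc (-inner ℝ ξ t) * fioCorrelation Φ σ f g (x, t) * Θ (x, ξ) = _
  ring

end correlation

/-! ### The kernel $k_I$ as a tempered distribution. -/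

section kernel

variable {d : ℕ} {Φ : Rd d × Rd d → ℝ} {σ : Rd d × Rd d → ℂ}

/-- The bounded function `e^{2πi Φ_I} σ_I`. -/
noncomputable def kernelSymbol (Φ : Rd d × Rd d → ℝ) (σ : Rd d × Rd d → ℂ)
    (p : (Rd d × Rd d) × (Rd d × Rd d)) : ℂ :=
  osc (phaseI Φ p.1.1 p.1.2 p.2.1 p.2.2) * symbolI σ p.1.1 p.1.2 p.2.1 p.2.2

theorem continuous_kernelSymbol (hΦ : IsTamePhase Φ) (hσ : IsHormanderSymbol σ) :
    Continuous (kernelSymbol Φ σ) := by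
  have h1 := hΦ.smooth.continuous
  have h2 := hσ.smooth.continuous
  unfold kernelSymbol phaseI symbolI
  exact (continuous_osc.comp (by fun_prop)).mul
    ((h2.comp (by fun_prop)).mul (Complex.continuous_conj.comp (h2.comp (by fun_prop))))

theorem exists_norm_kernelSymbol_le (hσ : IsHormanderSymbol σ) :
    ∃ C, ∀ p, ‖kernelSymbol Φ σ p‖ ≤ C := by
  obtain ⟨C, hC⟩ := hσ.bounded_deriv 0
  simp_rw [norm_iteratedFDeriv_zero] at hC
  refine ⟨C * C, fun p => ?_⟩
  rw [kernelSymbol, symbolI, norm_mul, norm_osc, one_mul, norm_mul, RCLike.norm_conj]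
  exact mul_le_mul (hC _) (hC _) (norm_nonneg _) ((norm_nonneg _).trans (hC 0))

/-- The rearrangement `((x, η), (ξ, y)) ↦ ((x, ξ), (y, η))`. -/
noncomputable def phaseSpaceEquiv (d : ℕ) :
    ((Rd d × Rd d) × (Rd d × Rd d)) ≃L[ℝ] ((Rd d × Rd d) × (Rd d × Rd d)) where
  toFun p := ((p.1.1, p.2.1), (p.2.2, p.1.2))
  invFun p := ((p.1.1, p.2.2), (p.1.2, p.2.1))
  map_add' _ _ := rfl
  map_smul' _ _ := rfl
  left_inv _ := rfl
  right_inv _ := rfl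
  continuous_toFun := by fun_prop
  continuous_invFun := by fun_prop

/-- The inner product of `ℝ^d × ℝ^d`. -/
noncomputable def prodInner (d : ℕ) : (Rd d × Rd d) →L[ℝ] (Rd d × Rd d) →L[ℝ] ℝ :=
  (innerSL ℝ).bilinearComp (.fst ℝ _ _) (.fst ℝ _ _) +
    (innerSL ℝ).bilinearComp (.snd ℝ _ _) (.snd ℝ _ _)

theorem prodInner_apply (v w : Rd d × Rd d) :
    prodInner d v w = inner ℝ v.1 w.1 + inner ℝ v.2 w.2 := rfl

/-- The product carries the maximum norm, so its square is only bounded by the sum of squares; the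
general pairing condition on $L$ accommodates this. -/
theorem prodInner_pairing (w : Rd d × Rd d) :
    ∃ v : Rd d × Rd d, ‖v‖ ≤ ‖w‖ ∧ ‖w‖ ^ 2 ≤ |prodInner d v w| := by
  refine ⟨w, le_rfl, le_trans ?_ (le_abs_self _)⟩
  rw [prodInner_apply, real_inner_self_eq_norm_sq, real_inner_self_eq_norm_sq, Prod.norm_def]
  rcases max_cases ‖w.1‖ ‖w.2‖ with h | h
  · rw [h.1]; nlinarith [sq_nonneg ‖w.2‖]
  · rw [h.1]; nlinarith [sq_nonneg ‖w.1‖]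

/-- The partial Fourier transform `(ξ, y) ↦ (t, r)` of Schwartz functions `Ψ(x, ξ, y, η)`. -/
noncomputable def kernelTransform (d : ℕ) :
    𝓢((Rd d × Rd d) × (Rd d × Rd d), ℂ) →L[ℂ] 𝓢((Rd d × Rd d) × (Rd d × Rd d), ℂ) :=
  (partialFourierCLM volume (prodInner d) prodInner_pairing).comp
    (SchwartzMap.compCLMOfContinuousLinearEquiv ℂ (phaseSpaceEquiv d))

theorem kernelTransform_apply (Ψ : 𝓢((Rd d × Rd d) × (Rd d × Rd d), ℂ))
    (p : (Rd d × Rd d) × (Rd d × Rd d)) :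
    kernelTransform d Ψ p = ∫ q : Rd d × Rd d,
      osc (-(inner ℝ q.1 p.2.1 + inner ℝ q.2 p.2.2)) * Ψ ((p.1.1, q.1), (q.2, p.1.2)) := rfl

theorem kernelPairingIntegrand_eq (Ψ : 𝓢((Rd d × Rd d) × (Rd d × Rd d), ℂ))
    (p : (Rd d × Rd d) × (Rd d × Rd d)) :
    kernelPairingIntegrand Φ σ Ψ p = kernelSymbol Φ σ p * kernelTransform d Ψ p := by
  simp_rw [kernelPairingIntegrand, exp_neg_eq_osc, kernelTransform_apply, real_inner_comm p.2.2]
  rfl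

theorem integrable_kernelPairingIntegrand (hΦ : IsTamePhase Φ) (hσ : IsHormanderSymbol σ)
    (Ψ : 𝓢((Rd d × Rd d) × (Rd d × Rd d), ℂ)) : Integrable (kernelPairingIntegrand Φ σ Ψ) := by
  obtain ⟨C, hC⟩ := exists_norm_kernelSymbol_le (Φ := Φ) hσ
  rw [funext (kernelPairingIntegrand_eq Ψ)]
  exact (kernelTransform d Ψ).integrable.bdd_mul (c := C)
    (continuous_kernelSymbol hΦ hσ).aestronglyMeasurable (.of_forall hC)

/-- The oscillatory integral `k_I` is a tempered distribution. -/
theorem exists_isTypeIKernel (hΦ : IsTamePhase Φ) (hσ : IsHormanderSymbol σ) :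
    ∃ k, IsTypeIKernel Φ σ k := by
  obtain ⟨C, hC⟩ := exists_norm_kernelSymbol_le (Φ := Φ) hσ
  have hm : MemLp (kernelSymbol Φ σ) ⊤ volume :=
    memLp_top_of_bound (continuous_kernelSymbol hΦ hσ).aestronglyMeasurable C (.of_forall hC)
  -- The bounded symbol defines a tempered distribution through $L^\infty$, and $k_I$ is its image
  -- under the transpose of the partial Fourier transform.
  refine ⟨PointwiseConvergenceCLM.precomp ℂ (kernelTransform d)
    (Lp.toTemperedDistribution (hm.toLp _)), fun Ψ =>
    ⟨integrable_kernelPairingIntegrand hΦ hσ Ψ, ?_⟩⟩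
  refine (Lp.toTemperedDistribution_apply (hm.toLp _) (kernelTransform d Ψ)).trans ?_
  refine integral_congr_ae ?_
  filter_upwards [hm.coeFn_toLp] with p hp
  rw [hp, kernelPairingIntegrand_eq, smul_eq_mul, mul_comm]

/-- On a tensor product the $(\xi,y)$-integral factors, and its $y$-part is the formula
`integral_osc_mul_crossWigner`. -/
theorem kernelTransform_tensor (Θ : 𝓢(Rd d × Rd d, ℂ)) (f g : 𝓢(Rd d, ℂ)) (x η t r : Rd d) :
    kernelTransform d (Θ.tensor (wignerSchwartz f g)) ((x, η), (t, r)) =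
      fourierSnd Θ (x, t) *
        ((𝓕 f) (η + (1 / 2 : ℝ) • r) * starRingEnd ℂ ((𝓕 g) (η - (1 / 2 : ℝ) • r))) := by
  rw [kernelTransform_apply, fourierSnd_apply, ← integral_osc_mul_crossWigner, ← integral_prod_mul]
  rw [← Measure.volume_eq_prod]
  congr 1
  ext q
  simp only [SchwartzMap.tensor_apply, wignerSchwartz_apply, neg_add, osc_add,
    real_inner_comm r q.2]
  ring

/-- Regrouping the variables as $((x,t),(\eta,r))$ makes the inner integral the one of
`integral_osc_phaseI`. Absolute convergence is part of `IsTypeIKernel`. -/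
theorem IsTypeIKernel.apply_tensor
    {k : 𝓢'((Rd d × Rd d) × (Rd d × Rd d), ℂ)} (hk : IsTypeIKernel Φ σ k)
    (Θ : 𝓢(Rd d × Rd d, ℂ)) (f g : 𝓢(Rd d, ℂ)) :
    k (Θ.tensor (wignerSchwartz f g)) = ∫ p, fourierSnd Θ p * fioCorrelation Φ σ f g p := by
  obtain ⟨hi, heq⟩ := hk (Θ.tensor (wignerSchwartz f g))
  have hmp := volume_preserving_prodProdComm (α := Rd d) (β := Rd d) (γ := Rd d) (δ := Rd d)
  have hemb :=
    (prodProdComm : (Rd d × Rd d) × (Rd d × Rd d) ≃ᵐ _).measurableEmbedding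
  rw [heq, ← hmp.integral_comp hemb]
  refine (integral_prod _ ((hmp.integrable_comp_emb hemb).2 hi)).trans ?_
  congr 1
  ext ⟨x, t⟩
  rw [fioCorrelation, ← integral_osc_phaseI, ← integral_const_mul]
  congr 1
  ext ⟨η, r⟩
  change kernelPairingIntegrand Φ σ _ ((x, η), (t, r)) = _
  rw [kernelPairingIntegrand_eq, kernelTransform_tensor, kernelSymbol]
  ring

end kernel

theorem theorem5p6 {d : ℕ} (Φ : Rd d × Rd d → ℝ) (σ : Rd d × Rd d → ℂ)
    (hΦ : IsTamePhase Φ) (hσ : IsHormanderSymbol σ) :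
    -- `T_I` maps `S(ℝ^d)` to `L²(ℝ^d)`, so that `W(T_I f, T_I g)` is defined
    (∀ f : 𝓢(Rd d, ℂ), MemLp (fioTypeI Φ σ f) 2) ∧
    -- `k_I` is a tempered distribution, it is the Wigner kernel of `T_I`,
    -- and `W(T_I f, T_I g) = ∫ k_I(·, w) W(f,g)(w) dw` in `S'(ℝ^{2d})`
    (∃ k : 𝓢'((Rd d × Rd d) × (Rd d × Rd d), ℂ),
      IsTypeIKernel Φ σ k ∧
      IsWignerKernel (fioTypeI Φ σ) k ∧
      ∀ (f g : 𝓢(Rd d, ℂ)) (Θ : 𝓢(Rd d × Rd d, ℂ)),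
        ∃ Ψ : 𝓢((Rd d × Rd d) × (Rd d × Rd d), ℂ),
          (∀ z w, Ψ (z, w) = Θ z * crossWigner f g w) ∧
          Integrable (fun z => crossWigner (fioTypeI Φ σ f) (fioTypeI Φ σ g) z * Θ z) ∧
          ∫ z, crossWigner (fioTypeI Φ σ f) (fioTypeI Φ σ g) z * Θ z = k Ψ) ∧
    -- the same identity at every point `z = (x,ξ)`, as an iterated integral
    (∀ (f g : 𝓢(Rd d, ℂ)) (z : Rd d × Rd d),
      Integrable (kernelActionIntegrand Φ σ (crossWigner f g) z) ∧
      crossWigner (fioTypeI Φ σ f) (fioTypeI Φ σ g) z =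
        ∫ t, kernelActionIntegrand Φ σ (crossWigner f g) z t) := by
  obtain ⟨k, hk⟩ := exists_isTypeIKernel hΦ hσ
  have hpair : ∀ (f g : 𝓢(Rd d, ℂ)) (Θ : 𝓢(Rd d × Rd d, ℂ)),
      ∫ z, crossWigner (fioTypeI Φ σ f) (fioTypeI Φ σ g) z * Θ z =
        k (Θ.tensor (wignerSchwartz f g)) := fun f g Θ =>
    (crossWigner_fioTypeI_pairing hΦ hσ f g Θ).2.trans (hk.apply_tensor Θ f g).symm
  refine ⟨fun f => (memLp_fioTypeI hΦ hσ f).2, ⟨k, hk, fun f g u v => ?_, fun f g Θ => ?_⟩,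
    fun f g z => ⟨integrable_kernelActionIntegrand hΦ hσ f g z,
      crossWigner_fioTypeI_eq_integral f g z⟩⟩
  -- The Wigner kernel property is the weak identity with $\Theta=\overline{W(u,v)}$.
  · refine ⟨(wignerSchwartz u v).conj.tensor (wignerSchwartz f g), fun z w => ?_, ?_⟩
    · rw [SchwartzMap.tensor_apply, SchwartzMap.conj_apply, wignerSchwartz_apply,
        wignerSchwartz_apply]
    · rw [← hpair]
      simp_rw [SchwartzMap.conj_apply, wignerSchwartz_apply]
  · refine ⟨Θ.tensor (wignerSchwartz f g), fun z w => ?_,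
      (crossWigner_fioTypeI_pairing hΦ hσ f g Θ).1, hpair f g Θ⟩
    rw [SchwartzMap.tensor_apply, wignerSchwartz_apply]
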